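/- An instance consists of a finite loopless multigraph with vertex set $N=\{1,\dots,n\}$ (the agents) and edge set $M=\{e_1,\dots,e_m\}$ (the items; parallel edges are allowed), together with a valuation $v_i\colon 2^M\to\mathbb{R}_{\ge 0}$ for each agent $i$ such that, with $E_i$ denoting the set of edges incident to $i$: $v_i$ is additive, i.e. $v_i(S)=\sum_{e\in S}v_i(\{e\})$ for all $S\subseteq M$; $v_i(S)=v_i(S\cap E_i)$ for all $S\subseteq M$; and $v_i$ is normalized, i.e. $\max_{e\in M}v_i(\{e\})=1$ (each agent's most valuable item has value exactly $1$). An orientation is a partition $\mathbf{A}=(A_1,\dots,A_n)$ of $M$ into possibly empty bundles with $A_i\subseteq E_i$ for every $i$. An orientation with payments $p_1,\dots,p_n\ge 0$ is envy-free if $v_i(A_i)+p_i\ge v_i(A_j)+p_j$ for all $i,j\in N$, and its total subsidy is $\sum_{i\in N}p_i$. Theorem. Every such instance has an envy-free orientation with payments whose total subsidy is at most $n/2$. Moreover, such an orientation together with its payments can be computed in polynomial time: there are a program for a random access machine (whose only arithmetic operations and tests are additions, subtractions and comparisons of natural numbers and of real numbers, each instruction or test counting as one step) and a polynomial $q$ such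 that, for every instance, the program, given $n$, $m$, the endpoints of every edge and the values $v_i(\{e\})$, outputs an orientation and payments with these properties after at most $q(n+m)$ steps. -/

import Mathlib

/-! ## Fair orientation instances -/

/-- An orientation instance: a loopless multigraph whose vertices `Fin n` are the agents and whose
edges `Fin m` are the items (parallel edges are allowed), with a monotone nonnegative valuation of
sets of items for each agent.  The two endpoints of an edge are listed in an arbitrary order. -/
structure OrientationInstance (n m : ℕ) where
  /-- one endpoint of an edge -/
  endA : Fin m → Fin n
  /-- the other endpoint of an edge -/
  endB : Fin m → Fin n
  loopless : ∀ e, endA e ≠ endB e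
  /-- the valuation functions -/
  v : Fin n → Finset (Fin m) → ℝ
  v_nonneg : ∀ i S, 0 ≤ v i S
  v_mono : ∀ i S T, S ⊆ T → v i S ≤ v i T
  /-- an agent only cares about the edges incident to her -/
  v_local : ∀ i S, v i S = v i (S.filter fun e => endA e = i ∨ endB e = i)
  /-- normalization: for each agent, the maximum marginal value of an item is `1` -/
  v_normalized : ∀ i, IsGreatest {x : ℝ | ∃ e S, x = v i (insert e S) - v i S} 1

namespace OrientationInstance

variable {n m : ℕ}

/-- All valuations are additive. -/
def IsAdditive (I : OrientationInstance n m) : Prop :=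
  ∀ i S, I.v i S = ∑ e ∈ S, I.v i {e}

/-- The edges incident to an agent. -/
def incident (I : OrientationInstance n m) (i : Fin n) : Finset (Fin m) :=
  Finset.univ.filter fun e => I.endA e = i ∨ I.endB e = i

/-- An orientation: a partition of the items into one (possibly empty) bundle for each agent, such
that every agent only receives edges incident to her. -/
def IsOrientation (I : OrientationInstance n m) (A : Fin n → Finset (Fin m)) : Prop :=
  (∀ i j, i ≠ j → Disjoint (A i) (A j)) ∧ (∀ e, ∃ i, e ∈ A i) ∧ ∀ i, A i ⊆ I.incident i

/-- The allocation `A` together with the subsidies `p` is envy-free. -/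
def IsEnvyFree (I : OrientationInstance n m) (A : Fin n → Finset (Fin m)) (p : Fin n → ℝ) : Prop :=
  (∀ i, 0 ≤ p i) ∧ ∀ i j, I.v i (A j) + p j ≤ I.v i (A i) + p i

/-- `A` with subsidies `p` is an envy-free orientation of total subsidy at most `b`. -/
def IsEFOrientationWithin (I : OrientationInstance n m) (A : Fin n → Finset (Fin m))
    (p : Fin n → ℝ) (b : ℝ) : Prop :=
  I.IsOrientation A ∧ I.IsEnvyFree A p ∧ ∑ i, p i ≤ b

end OrientationInstance

/-! ## The machine model

A uniform random access machine with finitely many tables of natural numbers and finitely many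
tables of real numbers, with computed (indirect) addressing.  The arithmetic is limited to addition,
subtraction and comparison, for natural numbers as well as for reals; there is no multiplication,
no rounding, and no conversion of a real into a natural number, so that polynomially many steps of
the machine cost polynomially many bit operations on rational inputs.  Every instruction and every
evaluation of a test counts as one step (expressions have a size fixed by the program). -/

/-- The read-only input of a machine: the numbers of agents and items, the two endpoints of every
item and the value of every single item for every agent. -/
structure RamInput where
  numAgents : ℕ
  numItems : ℕ
  endA : ℕ → ℕ
  endB : ℕ → ℕ
  value : ℕ → ℕ → ℝ

/-- The memory: `nat a i j` and `real a i j` are the entries in row `i` and column `j` of table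
number `a` of natural numbers, respectively of reals. -/
structure RamState where
  nat : ℕ → ℕ → ℕ → ℕ
  real : ℕ → ℕ → ℕ → ℝ

/-- The initial memory is zero everywhere. -/
def RamState.init : RamState := ⟨fun _ _ _ => 0, fun _ _ _ => 0⟩

/-- Expressions of natural number type; `sub` is truncated subtraction.  The name of the table that
is read is fixed in the program, its indices are computed. -/
inductive NatExpr where
  | const (k : ℕ)
  | numAgents
  | numItems
  | endA (e : NatExpr)
  | endB (e : NatExpr)
  | cell (a : ℕ) (i j : NatExpr)
  | add (x y : NatExpr)
  | sub (x y : NatExpr)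

/-- Expressions of real type. -/
inductive RealExpr where
  | zero
  | one
  | value (i e : NatExpr)
  | cell (a : ℕ) (i j : NatExpr)
  | add (x y : RealExpr)
  | sub (x y : RealExpr)

/-- Tests. -/
inductive RamTest where
  | natLe (x y : NatExpr)
  | realLe (x y : RealExpr)
  | not (b : RamTest)
  | and (b c : RamTest)

/-- Programs. -/
inductive RamProg where
  | skip
  | setNat (a : ℕ) (i j x : NatExpr)
  | setReal (a : ℕ) (i j : NatExpr) (x : RealExpr)
  | seq (c d : RamProg)
  | ite (b : RamTest) (c d : RamProg)
  | while (b : RamTest) (c : RamProg)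

def NatExpr.eval (X : RamInput) (s : RamState) : NatExpr → ℕ
  | const k => k
  | numAgents => X.numAgents
  | numItems => X.numItems
  | endA e => X.endA (e.eval X s)
  | endB e => X.endB (e.eval X s)
  | cell a i j => s.nat a (i.eval X s) (j.eval X s)
  | add x y => x.eval X s + y.eval X s
  | sub x y => x.eval X s - y.eval X s

noncomputable def RealExpr.eval (X : RamInput) (s : RamState) : RealExpr → ℝ
  | zero => 0
  | one => 1
  | value i e => X.value (i.eval X s) (e.eval X s)
  | cell a i j => s.real a (i.eval X s) (j.eval X s)
  | add x y => x.eval X s + y.eval X s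
  | sub x y => x.eval X s - y.eval X s

def RamTest.Holds (X : RamInput) (s : RamState) : RamTest → Prop
  | natLe x y => x.eval X s ≤ y.eval X s
  | realLe x y => x.eval X s ≤ y.eval X s
  | not b => ¬ b.Holds X s
  | and b c => b.Holds X s ∧ c.Holds X s

/-- Overwrite one entry of a table of natural numbers. -/
def RamState.writeNat (s : RamState) (a i j x : ℕ) : RamState :=
  { s with nat := fun a' i' j' => if a' = a ∧ i' = i ∧ j' = j then x else s.nat a' i' j' }

/-- Overwrite one entry of a table of reals. -/
noncomputable def RamState.writeReal (s : RamState) (a i j : ℕ) (x : ℝ) : RamState :=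
  { s with real := fun a' i' j' => if a' = a ∧ i' = i ∧ j' = j then x else s.real a' i' j' }

/-- `RamExec X c s t s'`: on input `X`, the program `c` started with memory `s` halts after exactly
`t` steps with memory `s'`. -/
inductive RamExec (X : RamInput) : RamProg → RamState → ℕ → RamState → Prop where
  | skip (s : RamState) : RamExec X .skip s 1 s
  | setNat (a : ℕ) (i j x : NatExpr) (s : RamState) :
      RamExec X (.setNat a i j x) s 1 (s.writeNat a (i.eval X s) (j.eval X s) (x.eval X s))
  | setReal (a : ℕ) (i j : NatExpr) (x : RealExpr) (s : RamState) :
      RamExec X (.setReal a i j x) s 1 (s.writeReal a (i.eval X s) (j.eval X s) (x.eval X s))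
  | seq {c d : RamProg} {s s' s'' : RamState} {t t' : ℕ} :
      RamExec X c s t s' → RamExec X d s' t' s'' → RamExec X (.seq c d) s (t + t') s''
  | iteTrue {b : RamTest} {c d : RamProg} {s s' : RamState} {t : ℕ} :
      b.Holds X s → RamExec X c s t s' → RamExec X (.ite b c d) s (1 + t) s'
  | iteFalse {b : RamTest} {c d : RamProg} {s s' : RamState} {t : ℕ} :
      ¬ b.Holds X s → RamExec X d s t s' → RamExec X (.ite b c d) s (1 + t) s'
  | whileTrue {b : RamTest} {c : RamProg} {s s' s'' : RamState} {t t' : ℕ} :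
      b.Holds X s → RamExec X c s t s' → RamExec X (.while b c) s' t' s'' →
        RamExec X (.while b c) s (1 + t + t') s''
  | whileFalse {b : RamTest} {c : RamProg} {s : RamState} :
      ¬ b.Holds X s → RamExec X (.while b c) s 1 s

/-- The instance as the input of a machine: agents and items are given by their numbers, and an
additive valuation by the values of the single items (out of range, every entry is `0`). -/
noncomputable def OrientationInstance.toInput {n m : ℕ} (I : OrientationInstance n m) : RamInput where
  numAgents := n
  numItems := m
  endA e := if h : e < m then (I.endA ⟨e, h⟩ : ℕ) else 0
  endB e := if h : e < m then (I.endB ⟨e, h⟩ : ℕ) else 0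
  value i e := if h : i < n ∧ e < m then I.v ⟨i, h.1⟩ {⟨e, h.2⟩} else 0

/-- The allocation that is written in the memory: row `0` of table `0` of natural numbers holds, in
column `e`, the number of the agent who receives item `e`. -/
def RamState.allocation (s : RamState) (n m : ℕ) : Fin n → Finset (Fin m) :=
  fun i => Finset.univ.filter fun e => s.nat 0 0 (e : ℕ) = (i : ℕ)

/-- The subsidies that are written in the memory: row `0` of table `0` of reals holds, in column
`i`, the subsidy of agent `i`. -/
def RamState.subsidy (s : RamState) (n : ℕ) : Fin n → ℝ :=
  fun i => s.real 0 0 (i : ℕ)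

/-!
Every agent `l` has a favourite edge, worth `1` to her; let `t l` be its other endpoint.  In the
graph of these pointers every component has exactly one cycle, and in a component whose cycle
consists of two agents pointing to each other, one of the two is called the starting agent.  The
edges are oriented pair by pair.  Between two agents that are not linked by a pointer, the edges
are split into two parts that differ by at most `1` for both agents, and handed out so as to
maximize the welfare.  Between `l` and `t l`, the edges other than the favourite of `l` are split
in the same way, and `l` usually keeps her favourite.  The exception concerns the chains that
begin at the starting agents: each agent on a chain takes over the favourite edge of the most
valuable one among those agents pointing to her who would otherwise cause a large envy
(`PairSplit.moved_gain`), and that agent is the next one on the chain.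

With `w a b` the envy of `a` towards `b`, the least envy-free payment of `a` is the maximum weight
of a walk from `a`.  Here round trips over two arcs have nonpositive weight
(`PairSplit.round_trip_nonpos`), so that only walks that do not turn back at once matter, and the
weight of such a walk after its arc from `b` to `a` is bounded by a number `PairSplit.cap` that
depends only on `a` and `b` (`PairSplit.step_le_cap`).  Hence (`IsRelaxation.le_bound`) a payment
is at most `1` for the last agent of a chain, `0` for one agent in each mutually pointing pair,
and `1/2` for all others (`PairSplit.step_le_bound`).  There is at most one chain for each such
pair, which gives the total of `n/2` (`PairSplit.sum_bound_le`).  As walk weights are bounded, the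
payments are reached after `n` rounds of relaxation (`IsRelaxation.stable`).

The construction is carried out by `orientProg`.  Programs are handled by the total-correctness
triples `Runs`, in which the number of steps is bounded by the polynomial `cost` that is read off
the program text; this is sound because every loop is a `forLoop` of length `n` or `m`
(`Runs.forLoop`).  The balanced partitions come from assigning the edges of a pair two at a time,
in the order of decreasing value for one of the agents (`Balanced.step`).
-/

namespace FairOrientation

/-! ### Payments by iterated relaxation -/

/-- `P k a` is the largest weight of a walk with at most `k` arcs that starts at `a`, where `w a b`
is the weight of the arc from `a` to `b`: the `k`-th round of the Bellman–Ford recursion. -/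
structure IsRelaxation {ι : Type*} (w : ι → ι → ℝ) (P : ℕ → ι → ℝ) : Prop where
  zero : ∀ a, P 0 a = 0
  nonneg : ∀ k a, 0 ≤ P k a
  le_succ : ∀ k a b, w a b + P k b ≤ P (k + 1) a
  attained : ∀ k a, P (k + 1) a = 0 ∨ ∃ b, P (k + 1) a = w a b + P k b

namespace IsRelaxation

variable {ι : Type*} {w : ι → ι → ℝ} {P : ℕ → ι → ℝ}

theorem mono (hP : IsRelaxation w P) (hw : ∀ a, w a a = 0) (a : ι) : Monotone fun k => P k a :=
  monotone_nat_of_le_succ fun k => by simpa [hw] using hP.le_succ k a a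

/-- If every round trip over two arcs has nonpositive weight and `π a b` bounds the weight of
continuing from `a` when the walk may not return to `b` at once, then a walk from `a` either has
weight at most `π a b` or begins with the arc to `b`. -/
theorem le_or_step (hP : IsRelaxation w P) (hw : ∀ a, w a a = 0)
    {π : ι → ι → ℝ} (hπ : ∀ a b, 0 ≤ π a b)
    (h2 : ∀ a b, a ≠ b → w a b + w b a ≤ 0)
    (h3 : ∀ a b c, a ≠ b → a ≠ c → b ≠ c → w a c + π c a ≤ π a b) :
    ∀ k a b, a ≠ b → P k a ≤ π a b ∨ (1 ≤ k ∧ P k a ≤ w a b + P (k - 1) b) := by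
  intro k
  induction k using Nat.strong_induction_on with
  | _ k ih =>
    intro a b hab
    have key : ∀ j, j < k → P k a ≤ P j a →
        P k a ≤ π a b ∨ (1 ≤ k ∧ P k a ≤ w a b + P (k - 1) b) := by
      intro j hj hle
      rcases ih j hj a b hab with h | ⟨h1, h⟩
      · exact Or.inl (hle.trans h)
      · have := hP.mono hw b (show j - 1 ≤ k - 1 by omega)
        exact Or.inr ⟨by omega, by simp only at this; linarith⟩
    rcases k with _ | k
    · exact Or.inl (by rw [hP.zero]; exact hπ a b)
    rcases hP.attained k a with h | ⟨c, hc⟩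
    · exact Or.inl (by rw [h]; exact hπ a b)
    by_cases hca : c = a
    · subst hca
      exact key k (by omega) (by rw [hc, hw, zero_add])
    by_cases hcb : c = b
    · subst hcb
      exact Or.inr ⟨by omega, by simp [hc]⟩
    rcases ih k (by omega) c a hca with h | ⟨h1, h⟩
    · have := h3 a b c hab (Ne.symm hca) (Ne.symm hcb)
      exact Or.inl (by linarith)
    · have := h2 a c (Ne.symm hca)
      exact key (k - 1) (by omega) (by linarith)

/-- A bound on the walks that start at `a`, by induction on the number of arcs: after the first
arc, to `c`, the walk either stays below `π c a`, or it returns to `a` at once and can be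
shortened. -/
theorem le_bound (hP : IsRelaxation w P) (hw : ∀ a, w a a = 0)
    {π : ι → ι → ℝ} (hπ : ∀ a b, 0 ≤ π a b)
    (h2 : ∀ a b, a ≠ b → w a b + w b a ≤ 0)
    (h3 : ∀ a b c, a ≠ b → a ≠ c → b ≠ c → w a c + π c a ≤ π a b)
    {B : ι → ℝ} (hB : ∀ a, 0 ≤ B a) (h4 : ∀ a c, a ≠ c → w a c + π c a ≤ B a) :
    ∀ k a, P k a ≤ B a := by
  intro k
  induction k using Nat.strong_induction_on with
  | _ k ih =>
    intro a
    rcases k with _ | k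
    · rw [hP.zero]; exact hB a
    rcases hP.attained k a with h | ⟨c, hc⟩
    · rw [h]; exact hB a
    by_cases hca : c = a
    · subst hca
      rw [hc, hw, zero_add]
      exact ih k (by omega) c
    rcases hP.le_or_step hw hπ h2 h3 k c a hca with h | ⟨h1, h⟩
    · have := h4 a c (Ne.symm hca)
      linarith
    · have := h2 a c (Ne.symm hca)
      have := ih (k - 1) (by omega) a
      linarith

/-- A strict increase in one round is caused by strict increases in all earlier rounds, along a
walk. -/
theorem exists_walk (hP : IsRelaxation w P) :
    ∀ k a, P k a < P (k + 1) a → ∃ c : ℕ → ι, c (k + 1) = a ∧ ∀ j ≤ k,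
      P j (c (j + 1)) < P (j + 1) (c (j + 1)) ∧
      P (j + 1) (c (j + 1)) = w (c (j + 1)) (c j) + P j (c j) := by
  intro k
  induction k with
  | zero =>
    intro a h
    rcases hP.attained 0 a with h0 | ⟨b, hb⟩
    · rw [hP.zero, h0] at h
      exact absurd h (lt_irrefl _)
    · refine ⟨fun j => if j = 0 then b else a, by simp, fun j hj => ?_⟩
      obtain rfl : j = 0 := by omega
      simpa using ⟨h, hb⟩
  | succ k ih =>
    intro a h
    rcases hP.attained (k + 1) a with h0 | ⟨b, hb⟩
    · have := hP.nonneg (k + 1) a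
      linarith
    · obtain ⟨c, hc, hcj⟩ := ih b (by have := hP.le_succ k a b; linarith)
      refine ⟨fun j => if j = k + 2 then a else c j, by simp, fun j hj => ?_⟩
      by_cases hjk : j = k + 1
      · subst hjk
        simpa [hc] using ⟨h, hb⟩
      · have h2 : j ≠ k + 2 := by omega
        simpa [hjk, h2] using hcj j (by omega)

/-- If the walk weights are bounded, no walk with more arcs than there are vertices improves on the
shorter ones; so the payments are stable after one round per vertex. -/
theorem stable [Fintype ι] (hP : IsRelaxation w P) (hw : ∀ a, w a a = 0) {B : ι → ℝ}
    (hB : ∀ k a, P k a ≤ B a) (a b : ι) :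
    w a b + P (Fintype.card ι) b ≤ P (Fintype.card ι) a := by
  set n := Fintype.card ι with hn
  by_contra! hlt
  obtain ⟨c, -, hc⟩ := hP.exists_walk n a (hlt.trans_le (hP.le_succ n a b))
  have bdd : ∀ a, BddAbove (Set.range fun k => P k a) := fun a =>
    ⟨B a, by rintro _ ⟨k, rfl⟩; exact hB k a⟩
  -- the limit of the rounds is a potential that no arc violates
  set q : ι → ℝ := fun a => ⨆ k, P k a with hq
  have hle : ∀ k a, P k a ≤ q a := fun k a => le_ciSup (bdd a) k
  have hfeas : ∀ a b, w a b + q b ≤ q a := by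
    intro a b
    have : q b ≤ q a - w a b := ciSup_le fun k => by
      have := hP.le_succ k a b
      have := hle (k + 1) a
      linarith
    linarith
  have hφ : ∀ i j, i ≤ j → j ≤ n + 1 → q (c i) - P i (c i) ≤ q (c j) - P j (c j) := by
    intro i j hij
    induction j, hij using Nat.le_induction with
    | base => intro _; exact le_rfl
    | succ j hij ih =>
      intro hj
      have h1 := ih (by omega)
      have h2 := (hc j (by omega)).2
      have h3 := hfeas (c (j + 1)) (c j)
      linarith
  obtain ⟨i, j, hij, hcij⟩ := Fintype.exists_ne_map_eq_of_card_lt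
    (fun i : Fin (n + 1) => c (i + 1)) (by simp [hn])
  have main : ∀ i j : ℕ, i < j → j ≤ n → c (i + 1) = c (j + 1) → False := by
    intro i j hij hj h
    have h1 := hφ (i + 1) (j + 1) (by omega) (by omega)
    have h2 := (hc j hj).1
    have h3 := hP.mono hw (c (j + 1)) (show i + 1 ≤ j by omega)
    simp only at h3
    rw [h] at h1
    linarith
  have hi := i.2
  have hj := j.2
  rcases lt_or_gt_of_ne (fun h => hij (Fin.ext h)) with h | h
  · exact main i j h (by omega) hcij
  · exact main j i h (by omega) hcij.symm

end IsRelaxation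

/-! ### Pairwise splits and caps on the payments -/

/-- The values that result from orienting the edges pair by pair, along pointers `t` (agent `l`
points to the other endpoint of her favourite edge `f`).

For `a ≠ b`, `g a b` is the value for `a` of the edges between `a` and `b` that `a` receives, and
`h a b` the value for `a` of those that `b` receives.  For the pair of `l` and `t l`, the edges
other than `f` are split into two parts: `x l`, `pl l`, `ql l` are the values for `t l` of `f` and
of the two parts, and `pc l`, `qc l` the values of the parts for `l`, who values `f` at `1` and
likes the first part better; `l` is called a child of `t l`.  `start` picks one agent out of each
mutually pointing pair, and `moved l` says that `t l` has taken the favourite edge of `l`. -/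
structure PairSplit {ι : Type*} (t : ι → ι) (start moved : ι → Prop) (x pl ql pc qc : ι → ℝ)
    (g h : ι → ι → ℝ) : Prop where
  t_ne : ∀ l, t l ≠ l
  start_mutual : ∀ l, start l → t (t l) = l
  not_start_partner : ∀ l, start l → ¬ start (t l)
  start_of_mutual : ∀ l, t (t l) = l → start l ∨ start (t l)
  not_start_of_moved : ∀ l, moved l → ¬ start l
  active_of_moved : ∀ l, moved l → start (t l) ∨ moved (t l)
  moved_unique : ∀ l l', moved l → moved l' → t l = t l' → l = l'
  moved_gain : ∀ l, moved l → 1 - x l < pl l - ql l ∧ pl l - ql l + 1 - x l < pc l - qc l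
  /-- If a child of an active agent satisfies the inequalities of `moved_gain`, the agent takes the
  favourite edge of the child among those for which this edge is worth most to her. -/
  exists_moved : ∀ l, ¬ start l → ¬ moved l → start (t l) ∨ moved (t l) →
    1 - x l < pl l - ql l ∧ pl l - ql l + 1 - x l < pc l - qc l →
    ∃ j, moved j ∧ t j = t l ∧ x l ≤ x j
  g_nonneg : ∀ a b, 0 ≤ g a b
  h_nonneg : ∀ a b, 0 ≤ h a b
  x_nonneg : ∀ l, 0 ≤ x l
  x_le : ∀ l, x l ≤ 1
  pl_nonneg : ∀ l, 0 ≤ pl l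
  ql_nonneg : ∀ l, 0 ≤ ql l
  qc_nonneg : ∀ l, 0 ≤ qc l
  pl_le : ∀ l, pl l ≤ ql l + 1
  qc_le : ∀ l, qc l ≤ pc l
  pc_le : ∀ l, pc l ≤ qc l + 1
  start_fav : ∀ l, start l → x (t l) = 1 ∨ 1 ≤ pl (t l) ∨ 1 ≤ ql (t l)
  moved_vals : ∀ l, moved l → g (t l) l = x l + ql l ∧ h (t l) l = pl l ∧
    g l (t l) = pc l ∧ h l (t l) = 1 + qc l
  keep_vals : ∀ l, ¬ start l → ¬ moved l →
    (x l + pl l ≤ 1 + ql l ∧ g (t l) l = ql l ∧ h (t l) l = x l + pl l ∧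
      g l (t l) = 1 + pc l ∧ h l (t l) = qc l) ∨
    (1 + ql l < x l + pl l ∧ g (t l) l = pl l ∧ h (t l) l = x l + ql l ∧
      g l (t l) = 1 + qc l ∧ h l (t l) = pc l)
  cross : ∀ a b, a ≠ b → ¬ (t b = a ∧ ¬ start b) → ¬ (t a = b ∧ ¬ start a) →
    h a b ≤ g a b + 1 ∧ h a b + h b a ≤ g a b + g b a

namespace PairSplit

variable {ι : Type*} [Fintype ι] {t : ι → ι} {start moved : ι → Prop}
  {x pl ql pc qc : ι → ℝ} {g h : ι → ι → ℝ}

open Classical in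
/-- The value that an active agent `a` gets from the child whose favourite edge she has taken,
unless this child is `b`. -/
noncomputable def reserve (t : ι → ι) (moved : ι → Prop) (g : ι → ι → ℝ) (a b : ι) : ℝ :=
  ∑ j with moved j ∧ t j = a ∧ j ≠ b, g a j

open Classical in
/-- A bound on the payment that `a` needs on account of agents other than `b`.  What `a` owns
between herself and `b` reduces it, and so does, for an active agent (a starting one or one whose
favourite edge has been taken), what she got from the child whose favourite edge she has taken. -/
noncomputable def cap (t : ι → ι) (start moved : ι → Prop) (g : ι → ι → ℝ) (a b : ι) : ℝ :=
  if start a ∨ moved a then max 0 (1 - g a b - reserve t moved g a b)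
  else if b = t a then 0 else max 0 (1 / 2 - g a b)

theorem cap_nonneg (a b : ι) : 0 ≤ cap t start moved g a b := by
  unfold cap
  split_ifs <;> simp

variable (S : PairSplit t start moved x pl ql pc qc g h)

include S

theorem reserve_nonneg (a b : ι) : 0 ≤ reserve t moved g a b :=
  Finset.sum_nonneg fun _ _ => S.g_nonneg _ _

theorem reserve_of_moved {j b : ι} (hj : moved j) (hb : j ≠ b) :
    reserve t moved g (t j) b = g (t j) j := by
  classical
  unfold reserve
  rw [Finset.sum_eq_single_of_mem j (by simp [hj, hb])]
  intro i hi hij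
  simp only [Finset.mem_filter, Finset.mem_univ, true_and] at hi
  exact absurd (S.moved_unique i j hi.1 hj hi.2.1) hij

theorem cap_le (a b : ι) : cap t start moved g a b ≤ max 0 (1 - g a b) := by
  have := S.reserve_nonneg a b
  unfold cap
  split_ifs
  · exact max_le_max le_rfl (by linarith)
  · simp
  · exact max_le_max le_rfl (by linarith)

omit S in
theorem cap_of_not_active {a : ι} (ha : ¬ (start a ∨ moved a)) :
    cap t start moved g a (t a) = 0 := by
  simp [cap, ha]

omit [Fintype ι] in
theorem half_lt_x {l : ι} (hl : 1 - x l < pl l - ql l ∧ pl l - ql l + 1 - x l < pc l - qc l) :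
    1 / 2 < x l := by
  have := S.pc_le l
  linarith [hl.1, hl.2]

omit S [Fintype ι] in
/-- Two agents are either linked by a pointer that is in use, or they are not. -/
theorem pair_cases {a b : ι} :
    (t b = a ∧ ¬ start b) ∨ (t a = b ∧ ¬ start a) ∨
      (¬ (t b = a ∧ ¬ start b) ∧ ¬ (t a = b ∧ ¬ start a)) := by
  tauto

/-- Not even counting what she gets elsewhere, an agent needs a payment of at most `1` because of a
single other agent. -/
theorem need_le_one {a c : ι} (hac : a ≠ c) :
    h a c + cap t start moved g c a ≤ 1 + g a c := by
  have hcap := S.cap_le c a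
  have hca := S.g_nonneg c a
  have hac0 := S.g_nonneg a c
  rcases pair_cases (t := t) (start := start) (a := a) (b := c) with
    ⟨rfl, hs⟩ | ⟨rfl, hs⟩ | ⟨h1, h2⟩
  · by_cases hm : moved c
    · obtain ⟨e1, e2, e3, e4⟩ := S.moved_vals c hm
      obtain ⟨m1, m2⟩ := S.moved_gain c hm
      rw [e3] at hcap
      have := S.qc_nonneg c
      rcases max_cases 0 (1 - pc c) with ⟨e, _⟩ | ⟨e, _⟩ <;> rw [e] at hcap <;>
        linarith [S.pl_le c, S.x_nonneg c, S.x_le c, S.pc_le c]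
    · rw [cap_of_not_active (by tauto)]
      rcases S.keep_vals c hs hm with ⟨m, e1, e2, e3, e4⟩ | ⟨m, e1, e2, e3, e4⟩ <;>
        linarith [S.x_le c, S.ql_nonneg c]
  · by_cases hm : moved a
    · obtain ⟨e1, e2, e3, e4⟩ := S.moved_vals a hm
      obtain ⟨m1, m2⟩ := S.moved_gain a hm
      rw [e1] at hcap
      rcases max_cases 0 (1 - (x a + ql a)) with ⟨e, _⟩ | ⟨e, _⟩ <;> rw [e] at hcap <;>
        linarith [S.qc_le a, S.x_le a, S.ql_nonneg a]
    · have : cap t start moved g (t a) a ≤ 1 := hcap.trans (max_le (by simp) (by linarith))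
      rcases S.keep_vals a hs hm with ⟨m, e1, e2, e3, e4⟩ | ⟨m, e1, e2, e3, e4⟩ <;>
        linarith [S.qc_le a, S.pc_le a]
  · obtain ⟨e1, e2⟩ := S.cross a c hac h1 h2
    obtain ⟨e3, e4⟩ := S.cross c a hac.symm h2 h1
    have := S.h_nonneg c a
    rcases max_cases 0 (1 - g c a) with ⟨e, _⟩ | ⟨e, _⟩ <;> rw [e] at hcap <;> linarith

/-- An agent who has taken the favourite edge of `l` needs no payment on account of `l`. -/
theorem need_moved {l : ι} (hl : moved l) :
    h (t l) l + cap t start moved g l (t l) ≤ g (t l) l := by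
  have hcap := S.cap_le l (t l)
  obtain ⟨e1, e2, e3, e4⟩ := S.moved_vals l hl
  obtain ⟨m1, m2⟩ := S.moved_gain l hl
  rw [e3] at hcap
  rcases max_cases 0 (1 - pc l) with ⟨e, _⟩ | ⟨e, _⟩ <;> rw [e] at hcap <;>
    linarith [S.pl_le l, S.x_nonneg l, S.x_le l, S.pc_le l, S.qc_nonneg l]

/-- Half a unit covers what an agent who owns her favourite edge needs on account of the agent she
points to. -/
theorem need_parent {a : ι} (hs : ¬ start a) (hm : ¬ moved a) :
    h a (t a) + cap t start moved g (t a) a ≤ 1 / 2 + g a (t a) := by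
  have hcap := S.cap_le (t a) a
  have hg := S.g_nonneg (t a) a
  have hone : cap t start moved g (t a) a ≤ 1 := hcap.trans (max_le (by simp) (by linarith))
  rcases S.keep_vals a hs hm with ⟨m, e1, e2, e3, e4⟩ | ⟨m, e1, e2, e3, e4⟩
  · linarith [S.qc_le a]
  have hpc := S.pc_le a
  by_cases hact : start (t a) ∨ moved (t a)
    -- under the inequalities of `moved_gain`, `t a` has taken another favourite edge, which is
    -- worth more than `1 / 2` to her
  · by_cases hmv : 1 - x a < pl a - ql a ∧ pl a - ql a + 1 - x a < pc a - qc a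
    · obtain ⟨j, hj, hjt, hxj⟩ := S.exists_moved a hs hm hact hmv
      have hja : j ≠ a := fun h => hm (h ▸ hj)
      have hr := S.reserve_of_moved hj hja
      have hx := S.half_lt_x hmv
      obtain ⟨e5, -⟩ := S.moved_vals j hj
      rw [hjt] at hr e5
      have : cap t start moved g (t a) a ≤ 1 / 2 := by
        rw [cap, if_pos hact, hr, e5]
        exact max_le (by norm_num) (by linarith [S.ql_nonneg j])
      linarith
    · rw [e1] at hcap
      have : pc a - qc a ≤ pl a - ql a + 1 - x a := by
        by_contra! hc
        exact hmv ⟨by linarith, hc⟩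
      rcases max_cases 0 (1 - pl a) with ⟨e, _⟩ | ⟨e, _⟩ <;> rw [e] at hcap <;>
        linarith [S.ql_nonneg a]
  · have : cap t start moved g (t a) a ≤ 1 / 2 := by
      rw [cap, if_neg hact]
      split_ifs
      · norm_num
      · exact max_le (by norm_num) (by linarith)
    linarith

omit [Fintype ι] in
/-- An agent who is not active owns her favourite edge. -/
theorem one_le_of_not_active {a : ι} (hs : ¬ start a) (hm : ¬ moved a) : 1 ≤ g a (t a) := by
  rcases S.keep_vals a hs hm with ⟨m, e1, e2, e3, e4⟩ | ⟨m, e1, e2, e3, e4⟩ <;>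
    linarith [S.qc_nonneg a, S.qc_le a]

theorem add_le_sum {a b c : ι} (hbc : b ≠ c) : g a b + g a c ≤ ∑ d, g a d := by
  classical
  rw [← Finset.sum_pair hbc]
  exact Finset.sum_le_sum_of_subset_of_nonneg (Finset.subset_univ _) fun i _ _ => S.g_nonneg a i

theorem add_add_le_sum {a b c d : ι} (hbc : b ≠ c) (hbd : b ≠ d) (hcd : c ≠ d) :
    g a b + g a c + g a d ≤ ∑ d, g a d := by
  classical
  have : ∑ i ∈ ({b, c, d} : Finset ι), g a i = g a b + g a c + g a d := by
    rw [Finset.sum_insert (by simp [hbc, hbd]), Finset.sum_pair hcd]; ring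
  rw [← this]
  exact Finset.sum_le_sum_of_subset_of_nonneg (Finset.subset_univ _) fun i _ _ => S.g_nonneg a i

theorem le_sum (a b : ι) : g a b ≤ ∑ d, g a d :=
  Finset.single_le_sum (fun i _ => S.g_nonneg a i) (Finset.mem_univ b)

omit S [Fintype ι] in
theorem reserve_cases (t : ι → ι) (moved : ι → Prop) [Fintype ι] (g : ι → ι → ℝ) (a b : ι) :
    reserve t moved g a b = 0 ∨ ∃ j, moved j ∧ t j = a ∧ j ≠ b := by
  by_cases h : ∃ j, moved j ∧ t j = a ∧ j ≠ b
  · exact Or.inr h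
  · left
    unfold reserve
    rw [Finset.sum_eq_zero]
    intro j hj
    exact absurd ⟨j, by simpa using hj⟩ h

/-- The caps are consistent along walks that do not turn back at once: the cap of `a` covers the
arc to `c` followed by the cap of `c`. -/
theorem step_le_cap {a b c : ι} (hab : a ≠ b) (hac : a ≠ c) (hbc : b ≠ c) :
    h a c - ∑ d, g a d + cap t start moved g c a ≤ cap t start moved g a b := by
  have h0 : 0 ≤ cap t start moved g a b := cap_nonneg a b
  have hneed := S.need_le_one hac
  by_cases hact : start a ∨ moved a
  · rw [cap.eq_def t start moved g a b, if_pos hact]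
    rcases reserve_cases t moved g a b with hr | ⟨j, hj, rfl, hjb⟩
    · rw [hr]
      exact le_max_of_le_right (by linarith [S.add_le_sum (a := a) hbc])
    rw [S.reserve_of_moved hj hjb]
    by_cases hjc : j = c
    · subst hjc
      exact le_max_of_le_left (by linarith [S.need_moved hj, S.le_sum (t j) j])
    · exact le_max_of_le_right
        (by linarith [S.add_add_le_sum (a := t j) hbc hjb.symm (Ne.symm hjc)])
  · rw [not_or] at hact
    have hone := S.one_le_of_not_active hact.1 hact.2
    by_cases hca : c = t a
    · subst hca
      rw [cap.eq_def t start moved g a b, if_neg (by tauto), if_neg hbc]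
      exact le_max_of_le_right
        (by linarith [S.add_le_sum (a := a) hbc, S.need_parent hact.1 hact.2])
    · linarith [S.add_le_sum (a := a) hca]

/-- The envies between two agents do not add up to a positive number. -/
theorem round_trip_nonpos {a b : ι} (hab : a ≠ b) :
    (h a b - ∑ d, g a d) + (h b a - ∑ d, g b d) ≤ 0 := by
  have child : ∀ l, ¬ start l →
      (h (t l) l - ∑ d, g (t l) d) + (h l (t l) - ∑ d, g l d) ≤ 0 := by
    intro l hs
    have hG := S.le_sum (t l) l
    have hG' := S.le_sum l (t l)
    by_cases hm : moved l
    · obtain ⟨e1, e2, e3, e4⟩ := S.moved_vals l hm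
      obtain ⟨m1, m2⟩ := S.moved_gain l hm
      linarith [S.x_le l]
    rcases S.keep_vals l hs hm with ⟨m, e1, e2, e3, e4⟩ | ⟨m, e1, e2, e3, e4⟩
    · linarith [S.qc_le l]
    by_cases hmv : pl l - ql l + 1 - x l < pc l - qc l
    · by_cases hact : start (t l) ∨ moved (t l)
      · obtain ⟨j, hj, hjt, hxj⟩ := S.exists_moved l hs hm hact ⟨by linarith, hmv⟩
        obtain ⟨e5, -⟩ := S.moved_vals j hj
        rw [hjt] at e5
        have hjl : l ≠ j := fun h => hm (h ▸ hj)
        linarith [S.add_le_sum (a := t l) hjl, S.ql_nonneg j, S.pc_le l, S.x_le l]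
      · rw [not_or] at hact
        have hne : l ≠ t (t l) := by
          intro e
          rcases S.start_of_mutual l e.symm with h | h <;> tauto
        linarith [S.add_le_sum (a := t l) hne, S.one_le_of_not_active hact.1 hact.2, S.pc_le l,
          S.x_le l]
    · linarith
  rcases pair_cases (t := t) (start := start) (a := a) (b := b) with
    ⟨rfl, hs⟩ | ⟨rfl, hs⟩ | ⟨h1, h2⟩
  · exact child b hs
  · linarith [child a hs]
  · linarith [(S.cross a b hab h1 h2).2, S.le_sum a b, S.le_sum b a]

/-- The agents that end up without payment: for each mutually pointing pair, one of the two. -/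
def Free (t : ι → ι) (start moved : ι → Prop) (a : ι) : Prop :=
  (start a ∧ moved (t a)) ∨ (start (t a) ∧ ¬ start a ∧ t (t a) = a ∧ ¬ moved a)

/-- The active agents that have not taken the favourite edge of a child. -/
def Final (t : ι → ι) (start moved : ι → Prop) (a : ι) : Prop :=
  (start a ∨ moved a) ∧ ∀ j, moved j → t j ≠ a

open Classical in
/-- A bound on the payment of an agent. -/
noncomputable def bound (t : ι → ι) (start moved : ι → Prop) (a : ι) : ℝ :=
  if Final t start moved a then 1 else if Free t start moved a then 0 else 1 / 2

/-- If a starting agent leaves the favourite edge of her partner alone, the partner needs no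
payment on account of her. -/
theorem start_need {i : ι} (hi : start i) (hm : ¬ moved (t i)) :
    h (t i) i + cap t start moved g i (t i) ≤ g (t i) i := by
  have hs := S.not_start_partner i hi
  have hti := S.start_mutual i hi
  have hcap := S.cap_le i (t i)
  have hg := S.g_nonneg i (t i)
  have hone : cap t start moved g i (t i) ≤ 1 := hcap.trans (max_le (by simp) (by linarith))
  have hpc := S.pc_le (t i)
  have hx := S.x_le (t i)
  rcases S.keep_vals (t i) hs hm with ⟨m, e1, e2, e3, e4⟩ | ⟨m, e1, e2, e3, e4⟩ <;>
    rw [hti] at e1 e2 e3 e4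
  · linarith [S.qc_le (t i)]
  rw [e1] at hcap
  by_cases hpl : 1 ≤ pl (t i)
  · rw [max_eq_left (by linarith)] at hcap
    linarith
  have hx1 : x (t i) = 1 := by
    rcases S.start_fav i hi with h | h | h
    · exact h
    · exact absurd h hpl
    · linarith
  by_cases hmv : pl (t i) - ql (t i) + 1 - x (t i) < pc (t i) - qc (t i)
  · obtain ⟨j, hj, hjt, hxj⟩ := S.exists_moved (t i) hs hm (by rw [hti]; exact Or.inl hi)
      ⟨by linarith, hmv⟩
    rw [hti] at hjt
    have hr := S.reserve_of_moved hj (b := t i) (fun h => hm (h ▸ hj))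
    obtain ⟨e5, -⟩ := S.moved_vals j hj
    rw [hjt] at hr e5
    have : cap t start moved g i (t i) ≤ 0 := by
      rw [cap, if_pos (Or.inl hi), hr, e5]
      exact max_le le_rfl (by linarith [S.ql_nonneg j])
    linarith
  · rcases max_cases 0 (1 - pl (t i)) with ⟨e, _⟩ | ⟨e, _⟩ <;> rw [e] at hcap <;>
      linarith [S.ql_nonneg (t i)]

/-- Decomposing a walk at its first arc, the caps bound the payments. -/
theorem step_le_bound {a c : ι} (hac : a ≠ c) :
    h a c - ∑ d, g a d + cap t start moved g c a ≤ bound t start moved a := by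
  have hneed := S.need_le_one hac
  have hGc := S.le_sum a c
  unfold bound
  split_ifs with hZ hF
  · linarith
  · rcases hF with ⟨hi, hm⟩ | ⟨hi, hs, hti, hm⟩
    · obtain ⟨e1, e2, e3, e4⟩ := S.moved_vals (t a) hm
      obtain ⟨m1, m2⟩ := S.moved_gain (t a) hm
      rw [S.start_mutual a hi] at e1 e2 e3 e4
      by_cases hca : c = t a
      · subst hca
        have := S.need_moved hm
        rw [S.start_mutual a hi] at this
        linarith
      · have : 1 ≤ g a (t a) := by
          rw [e1]
          rcases S.start_fav a hi with h | h | h <;>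
            linarith [S.x_nonneg (t a), S.ql_nonneg (t a), S.pc_le (t a)]
        linarith [S.add_le_sum (a := a) hca]
    · by_cases hca : c = t a
      · subst hca
        have := S.start_need hi (by rwa [hti])
        rw [hti] at this
        linarith
      · linarith [S.add_le_sum (a := a) hca, S.one_le_of_not_active hs hm]
  · by_cases hact : start a ∨ moved a
    · simp only [Final, hact, true_and, not_forall, not_not] at hZ
      obtain ⟨j, hj, rfl⟩ := hZ
      obtain ⟨e1, -⟩ := S.moved_vals j hj
      have hx := S.half_lt_x (S.moved_gain j hj)
      by_cases hjc : j = c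
      · subst hjc
        linarith [S.need_moved hj]
      · linarith [S.add_le_sum (a := t j) hjc, S.ql_nonneg j]
    · rw [not_or] at hact
      have hone := S.one_le_of_not_active hact.1 hact.2
      by_cases hca : c = t a
      · subst hca
        linarith [S.need_parent hact.1 hact.2]
      · linarith [S.add_le_sum (a := a) hca]

omit S [Fintype ι] in
theorem bound_nonneg (a : ι) : 0 ≤ bound t start moved a := by
  unfold bound
  split_ifs <;> norm_num

/-- There are at most as many final agents as mutually pointing pairs, and each such pair contains
an agent without payment. -/
theorem sum_bound_le : ∑ a, bound t start moved a ≤ (Fintype.card ι : ℝ) / 2 := by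
  classical
  have hdisj : ∀ a, Final t start moved a → ¬ Free t start moved a := by
    rintro a ⟨h1, h2⟩ (⟨h3, h4⟩ | ⟨h3, h4, h5, h6⟩)
    · exact h2 (t a) h4 (S.start_mutual a h3)
    · tauto
  have hb : ∀ a, bound t start moved a = 1 / 2 + (if Final t start moved a then (1 / 2 : ℝ) else 0)
      - (if Free t start moved a then (1 / 2 : ℝ) else 0) := by
    intro a
    unfold bound
    by_cases h1 : Final t start moved a
    · simp [h1, hdisj a h1]; norm_num
    · by_cases h2 : Free t start moved a <;> simp [h1, h2]
  let Z := Finset.univ.filter fun a => Final t start moved a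
  let F := Finset.univ.filter fun a => Free t start moved a
  let St := Finset.univ.filter fun a => start a
  let Mv := Finset.univ.filter fun a => moved a
  -- each starting agent has an agent without payment in her pair
  have hF : St.card ≤ F.card := by
    refine Finset.card_le_card_of_injOn (fun a => if moved (t a) then a else t a) ?_ ?_
    · intro a ha
      have ha : start a := by simpa [St] using ha
      by_cases hm : moved (t a)
      · simp only [hm, if_true]
        exact Finset.mem_filter.2 ⟨Finset.mem_univ _, Or.inl ⟨ha, hm⟩⟩
      · have := S.start_mutual a ha
        simp only [hm, if_false]
        exact Finset.mem_filter.2 ⟨Finset.mem_univ _,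
          Or.inr ⟨by rwa [this], S.not_start_partner a ha, by rw [this], hm⟩⟩
    · intro a ha b hb hab
      have ha : start a := by simpa [St] using ha
      have hb : start b := by simpa [St] using hb
      have h1 := S.start_mutual a ha
      have h2 := S.start_mutual b hb
      have h3 := S.not_start_partner a ha
      have h4 := S.not_start_partner b hb
      simp only at hab
      split_ifs at hab with h5 h6 h6
      · exact hab
      · exact absurd (hab ▸ ha) h4
      · exact absurd (hab ▸ hb) h3
      · rw [← h1, hab, h2]
  -- the final agents and the images of the moved ones are disjoint, and all of them are active
  have hZ : Z.card + Mv.card ≤ St.card + Mv.card := by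
    have h1 : Mv.card = (Mv.image t).card :=
      (Finset.card_image_of_injOn fun a ha b hb hab =>
        S.moved_unique a b (by simpa [Mv] using ha) (by simpa [Mv] using hb) hab).symm
    have h2 : Disjoint Z (Mv.image t) := by
      rw [Finset.disjoint_left]
      intro a ha ha'
      obtain ⟨j, hj, rfl⟩ := Finset.mem_image.1 ha'
      have ha : Final t start moved (t j) := by simpa [Z] using ha
      exact ha.2 j (by simpa [Mv] using hj) rfl
    have h3 : Z ∪ Mv.image t ⊆ St ∪ Mv := by
      intro a ha
      rcases Finset.mem_union.1 ha with ha | ha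
      · have ha : Final t start moved a := by simpa [Z] using ha
        simpa [St, Mv] using ha.1
      · obtain ⟨j, hj, rfl⟩ := Finset.mem_image.1 ha
        simpa [St, Mv] using S.active_of_moved j (by simpa [Mv] using hj)
    calc Z.card + Mv.card = (Z ∪ Mv.image t).card := by rw [h1, Finset.card_union_of_disjoint h2]
      _ ≤ (St ∪ Mv).card := Finset.card_le_card h3
      _ ≤ _ := Finset.card_union_le _ _
  have hZF : (Z.card : ℝ) ≤ F.card := by exact_mod_cast (by omega : Z.card ≤ F.card)
  simp_rw [hb]
  rw [Finset.sum_sub_distrib, Finset.sum_add_distrib, Finset.sum_const, ← Finset.sum_filter,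
    ← Finset.sum_filter, Finset.sum_const, Finset.sum_const, Finset.card_univ]
  simp only [nsmul_eq_mul]
  change _ + (Z.card : ℝ) * _ - (F.card : ℝ) * _ ≤ _
  linarith

/-- The payments obtained after one round of relaxation per agent are envy-free, and their sum is
at most half the number of agents. -/
theorem payments {w : ι → ι → ℝ} {P : ℕ → ι → ℝ} (hP : IsRelaxation w P) (hw0 : ∀ a, w a a = 0)
    (hw : ∀ a b, a ≠ b → w a b = h a b - ∑ d, g a d) :
    (∀ a b, w a b + P (Fintype.card ι) b ≤ P (Fintype.card ι) a) ∧
      ∑ a, P (Fintype.card ι) a ≤ (Fintype.card ι : ℝ) / 2 := by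
  have hB := hP.le_bound hw0 (π := cap t start moved g) cap_nonneg
    (fun a b hab => by rw [hw a b hab, hw b a hab.symm]; exact S.round_trip_nonpos hab)
    (fun a b c hab hac hbc => by rw [hw a c hac]; exact S.step_le_cap hab hac hbc)
    (B := bound t start moved) bound_nonneg
    (fun a c hac => by rw [hw a c hac]; exact S.step_le_bound hac)
  exact ⟨hP.stable hw0 hB, (Finset.sum_le_sum fun a _ => hB _ a).trans S.sum_bound_le⟩

end PairSplit

/-! ### Reasoning about programs -/

open Polynomial in
/-- A bound on the number of steps of a program whose loops run at most `X` times each. -/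
noncomputable def cost : RamProg → Polynomial ℕ
  | .skip => 1
  | .setNat _ _ _ _ => 1
  | .setReal _ _ _ _ => 1
  | .seq c d => cost c + cost d
  | .ite _ c d => 1 + (cost c + cost d)
  | .while _ c => X * (1 + cost c) + 1

/-- Does the program contain an assignment to table `a` of natural numbers? -/
def writesNat (a : ℕ) : RamProg → Bool
  | .skip => false
  | .setNat a' _ _ _ => a == a'
  | .setReal _ _ _ _ => false
  | .seq c d => writesNat a c || writesNat a d
  | .ite _ c d => writesNat a c || writesNat a d
  | .while _ c => writesNat a c

/-- Does the program contain an assignment to table `a` of reals? -/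
def writesReal (a : ℕ) : RamProg → Bool
  | .skip => false
  | .setNat _ _ _ _ => false
  | .setReal a' _ _ _ => a == a'
  | .seq c d => writesReal a c || writesReal a d
  | .ite _ c d => writesReal a c || writesReal a d
  | .while _ c => writesReal a c

/-- The memories `s` and `s'` agree on all tables to which `c` does not write. -/
structure Agree (c : RamProg) (s s' : RamState) : Prop where
  nat : ∀ a, writesNat a c = false → s'.nat a = s.nat a
  real : ∀ a, writesReal a c = false → s'.real a = s.real a

theorem Agree.refl (c : RamProg) (s : RamState) : Agree c s s := ⟨fun _ _ => rfl, fun _ _ => rfl⟩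

theorem Agree.trans {c : RamProg} {s s' s'' : RamState} (h : Agree c s s') (h' : Agree c s' s'') :
    Agree c s s'' :=
  ⟨fun a ha => (h'.nat a ha).trans (h.nat a ha), fun a ha => (h'.real a ha).trans (h.real a ha)⟩

theorem Agree.mono {c d : RamProg} {s s' : RamState} (h : Agree c s s')
    (hn : ∀ a, writesNat a d = false → writesNat a c = false)
    (hr : ∀ a, writesReal a d = false → writesReal a c = false) : Agree d s s' :=
  ⟨fun a ha => h.nat a (hn a ha), fun a ha => h.real a (hr a ha)⟩

@[simp] theorem writeNat_nat (s : RamState) (a i j x a' i' j' : ℕ) :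
    (s.writeNat a i j x).nat a' i' j' = if a' = a ∧ i' = i ∧ j' = j then x else s.nat a' i' j' :=
  rfl

@[simp] theorem writeNat_real (s : RamState) (a i j x : ℕ) : (s.writeNat a i j x).real = s.real :=
  rfl

@[simp] theorem writeReal_real (s : RamState) (a i j : ℕ) (x : ℝ) (a' i' j' : ℕ) :
    (s.writeReal a i j x).real a' i' j' = if a' = a ∧ i' = i ∧ j' = j then x else s.real a' i' j' :=
  rfl

@[simp] theorem writeReal_nat (s : RamState) (a i j : ℕ) (x : ℝ) :
    (s.writeReal a i j x).nat = s.nat := rfl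

theorem writeNat_nat_of_ne (s : RamState) {a a' : ℕ} (i j x : ℕ) (h : a' ≠ a) :
    (s.writeNat a i j x).nat a' = s.nat a' := by
  funext i' j'; simp [h]

theorem writeReal_real_of_ne (s : RamState) {a a' : ℕ} (i j : ℕ) (x : ℝ) (h : a' ≠ a) :
    (s.writeReal a i j x).real a' = s.real a' := by
  funext i' j'; simp [h]

theorem agree_of_exec {X : RamInput} {c : RamProg} {s s' : RamState} {k : ℕ}
    (h : RamExec X c s k s') : Agree c s s' := by
  induction h with
  | skip s => exact Agree.refl _ _
  | setNat a i j x s =>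
    refine ⟨fun a' h => writeNat_nat_of_ne _ _ _ _ ?_, fun a' h => rfl⟩
    simpa [writesNat] using h
  | setReal a i j x s =>
    refine ⟨fun a' h => rfl, fun a' h => writeReal_real_of_ne _ _ _ _ ?_⟩
    simpa [writesReal] using h
  | seq _ _ ih1 ih2 =>
    exact (ih1.mono (by simp +contextual [writesNat]) (by simp +contextual [writesReal])).trans
      (ih2.mono (by simp +contextual [writesNat]) (by simp +contextual [writesReal]))
  | iteTrue _ _ ih =>
    exact ih.mono (by simp +contextual [writesNat]) (by simp +contextual [writesReal])
  | iteFalse _ _ ih =>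
    exact ih.mono (by simp +contextual [writesNat]) (by simp +contextual [writesReal])
  | @whileTrue b c s s' s'' _ _ _ _ _ ih1 ih2 =>
    have h1 : Agree (.while b c) s s' := ih1.mono (fun _ h => h) (fun _ h => h)
    exact h1.trans ih2
  | whileFalse _ => exact Agree.refl _ _

/-- Total correctness: started with memory `s`, the program halts within its cost, with a memory
that satisfies `Q`. -/
def Runs (X : RamInput) (c : RamProg) (s : RamState) (Q : RamState → Prop) : Prop :=
  ∃ k s', RamExec X c s k s' ∧ k ≤ (cost c).eval (X.numAgents + X.numItems) ∧ Q s'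

namespace Runs

variable {X : RamInput} {c d : RamProg} {s : RamState} {Q R : RamState → Prop}

theorem imp (h : Runs X c s Q) (hQ : ∀ s', Q s' → R s') : Runs X c s R := by
  obtain ⟨k, s', h1, h2, h3⟩ := h
  exact ⟨k, s', h1, h2, hQ s' h3⟩

theorem imp_agree (h : Runs X c s Q) (hQ : ∀ s', Q s' → Agree c s s' → R s') : Runs X c s R := by
  obtain ⟨k, s', h1, h2, h3⟩ := h
  exact ⟨k, s', h1, h2, hQ s' h3 (agree_of_exec h1)⟩

theorem skip (h : Q s) : Runs X .skip s Q := ⟨1, s, .skip s, by simp [cost], h⟩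

theorem setNat {a : ℕ} {i j x : NatExpr}
    (h : Q (s.writeNat a (i.eval X s) (j.eval X s) (x.eval X s))) :
    Runs X (.setNat a i j x) s Q :=
  ⟨1, _, .setNat a i j x s, by simp [cost], h⟩

theorem setReal {a : ℕ} {i j : NatExpr} {x : RealExpr}
    (h : Q (s.writeReal a (i.eval X s) (j.eval X s) (x.eval X s))) :
    Runs X (.setReal a i j x) s Q :=
  ⟨1, _, .setReal a i j x s, by simp [cost], h⟩

theorem seq (h : Runs X c s fun s' => Runs X d s' Q) : Runs X (.seq c d) s Q := by
  obtain ⟨k, s', h1, h2, k', s'', h3, h4, h5⟩ := h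
  exact ⟨k + k', s'', h1.seq h3, by simpa [cost] using Nat.add_le_add h2 h4, h5⟩

theorem ite {b : RamTest} (h1 : b.Holds X s → Runs X c s Q) (h2 : ¬ b.Holds X s → Runs X d s Q) :
    Runs X (.ite b c d) s Q := by
  by_cases hb : b.Holds X s
  · obtain ⟨k, s', h3, h4, h5⟩ := h1 hb
    exact ⟨1 + k, s', .iteTrue hb h3, by simp [cost]; omega, h5⟩
  · obtain ⟨k, s', h3, h4, h5⟩ := h2 hb
    exact ⟨1 + k, s', .iteFalse hb h3, by simp [cost]; omega, h5⟩

end Runs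

/-- The scalar variable that is kept in the corner of table `a` of natural numbers. -/
@[reducible] def var (a : ℕ) : NatExpr := .cell a (.const 0) (.const 0)

/-- The scalar variable that is kept in the corner of table `a` of reals. -/
@[reducible] def rvar (a : ℕ) : RealExpr := .cell a (.const 0) (.const 0)

/-- Assignment to a scalar variable. -/
@[reducible] def setVar (a : ℕ) (x : NatExpr) : RamProg := .setNat a (.const 0) (.const 0) x

/-- Assignment to a scalar variable. -/
@[reducible] def setRvar (a : ℕ) (x : RealExpr) : RamProg := .setReal a (.const 0) (.const 0) x

/-- The loop in which the variable `c` runs from `0` to `b - 1`. -/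
def forLoop (c : ℕ) (b : NatExpr) (body : RamProg) : RamProg :=
  .seq (setVar c (.const 0))
    (.while (.not (.natLe b (var c))) (.seq body (setVar c (.add (var c) (.const 1)))))

/-- The invariant rule for loops.  The invariant must not depend on the loop variable, and may
rely on the tables to which the loop does not write.  The bound `N` on the rounds is at most
`numAgents + numItems`, the point at which `cost` is evaluated. -/
theorem Runs.forLoop {X : RamInput} {c : ℕ} {b : NatExpr} {body : RamProg} {s : RamState}
    {Q : RamState → Prop} (N : ℕ) (I : ℕ → RamState → Prop)
    (hN : N ≤ X.numAgents + X.numItems) (hb : ∀ s', b.eval X s' = N)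
    (hc : writesNat c body = false)
    (hI : ∀ k s' x, I k s' → I k (s'.writeNat c 0 0 x))
    (h0 : I 0 s)
    (hstep : ∀ k < N, ∀ s', Agree (forLoop c b body) s s' → s'.nat c 0 0 = k → I k s' →
      Runs X body s' (I (k + 1)))
    (hend : ∀ s', Agree (forLoop c b body) s s' → I N s' → Q s') :
    Runs X (forLoop c b body) s Q := by
  set L := FairOrientation.forLoop c b body with hL
  set w : RamProg := .while (.not (.natLe b (var c)))
    (.seq body (setVar c (.add (var c) (.const 1)))) with hw
  have hwL : ∀ {s s'}, Agree w s s' → Agree L s s' := fun h => by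
    refine h.mono ?_ ?_ <;>
      simp +contextual [hL, hw, FairOrientation.forLoop, writesNat, writesReal]
  have key : ∀ r k s', r + k = N → Agree L s s' → s'.nat c 0 0 = k → I k s' →
      ∃ t s'', RamExec X w s' t s'' ∧
        t ≤ r * (1 + (cost body + 1).eval (X.numAgents + X.numItems)) + 1 ∧
        Agree L s s'' ∧ I N s'' := by
    intro r
    induction r with
    | zero =>
      intro k s' hk ha hs hIk
      refine ⟨1, s', .whileFalse ?_, by simp, ha, ?_⟩
      · simp [RamTest.Holds, NatExpr.eval, hb, hs]; omega
      · obtain rfl : k = N := by omega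
        exact hIk
    | succ r ih =>
      intro k s' hk ha hs hIk
      obtain ⟨t1, s1, e1, ht1, hI1⟩ := hstep k (by omega) s' ha hs hIk
      have hc1 : s1.nat c 0 0 = k := by
        rw [(agree_of_exec e1).nat c hc]; exact hs
      have e2 : RamExec X (setVar c (.add (var c) (.const 1))) s1 1
          (s1.writeNat c 0 0 (k + 1)) := by
        have := RamExec.setNat (X := X) c (.const 0) (.const 0) (.add (var c) (.const 1)) s1
        simpa [NatExpr.eval, hc1] using this
      have hbt : RamTest.Holds X s' (.not (.natLe b (var c))) := by
        simp [RamTest.Holds, NatExpr.eval, hb, hs]; omega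
      have ha2 : Agree w s' (s1.writeNat c 0 0 (k + 1)) := by
        refine (agree_of_exec (e1.seq e2)).mono ?_ ?_ <;> simp [hw, writesNat, writesReal]
      obtain ⟨t2, s2, e3, ht2, ha3, hI3⟩ := ih (k + 1) _ (by omega) (ha.trans (hwL ha2)) (by simp)
        (hI _ _ _ hI1)
      refine ⟨1 + (t1 + 1) + t2, s2, .whileTrue hbt (e1.seq e2) e3, ?_, ha3, hI3⟩
      simp only [Polynomial.eval_add, Polynomial.eval_one] at ht2 ⊢
      nlinarith
  have e0 : RamExec X (setVar c (.const 0)) s 1 (s.writeNat c 0 0 0) :=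
    RamExec.setNat (X := X) c (.const 0) (.const 0) (.const 0) s
  have ha0 : Agree L s (s.writeNat c 0 0 0) := by
    refine (agree_of_exec e0).mono ?_ ?_ <;>
      simp +contextual [hL, FairOrientation.forLoop, writesNat, writesReal]
  obtain ⟨t, s', e, ht, ha, hIN⟩ := key N 0 _ (by omega) ha0 (by simp) (hI _ _ _ h0)
  refine ⟨1 + t, s', e0.seq e, ?_, hend s' ha hIN⟩
  have : N * (1 + (cost body + 1).eval (X.numAgents + X.numItems)) ≤
      (X.numAgents + X.numItems) * (1 + (cost body + 1).eval (X.numAgents + X.numItems)) :=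
    Nat.mul_le_mul_right _ hN
  simp only [Polynomial.eval_add, Polynomial.eval_one] at this ht
  simp only [hL, FairOrientation.forLoop, cost, Polynomial.eval_add, Polynomial.eval_one,
    Polynomial.eval_mul, Polynomial.eval_X]
  omega

/-- Disjunction of tests. -/
def orTest (b c : RamTest) : RamTest := .not (.and (.not b) (.not c))

/-- Equality test. -/
def eqTest (x y : NatExpr) : RamTest := .and (.natLe x y) (.natLe y x)

@[simp] theorem holds_and {X : RamInput} {s : RamState} {b c : RamTest} :
    (RamTest.and b c).Holds X s ↔ b.Holds X s ∧ c.Holds X s := Iff.rfl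

@[simp] theorem holds_not {X : RamInput} {s : RamState} {b : RamTest} :
    (RamTest.not b).Holds X s ↔ ¬ b.Holds X s := Iff.rfl

@[simp] theorem holds_or {X : RamInput} {s : RamState} {b c : RamTest} :
    (orTest b c).Holds X s ↔ b.Holds X s ∨ c.Holds X s := by
  simp only [orTest, RamTest.Holds]; tauto

@[simp] theorem holds_eq {X : RamInput} {s : RamState} {x y : NatExpr} :
    (eqTest x y).Holds X s ↔ x.eval X s = y.eval X s := by
  simp only [eqTest, RamTest.Holds]; omega

@[simp] theorem holds_natLe {X : RamInput} {s : RamState} {x y : NatExpr} :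
    (RamTest.natLe x y).Holds X s ↔ x.eval X s ≤ y.eval X s := Iff.rfl

@[simp] theorem holds_realLe {X : RamInput} {s : RamState} {x y : RealExpr} :
    (RamTest.realLe x y).Holds X s ↔ x.eval X s ≤ y.eval X s := Iff.rfl

theorem writeNat_row (s : RamState) (a i j x : ℕ) :
    (s.writeNat a i j x).nat a i = Function.update (s.nat a i) j x := by
  funext j'
  by_cases h : j' = j <;> simp [h, Function.update]

theorem writeNat_row_of_ne (s : RamState) {a i a' i' : ℕ} (j x : ℕ) (h : ¬ (a' = a ∧ i' = i)) :
    (s.writeNat a i j x).nat a' i' = s.nat a' i' := by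
  funext j'
  rw [writeNat_nat, if_neg (by tauto)]

attribute [simp] NatExpr.eval RealExpr.eval

/-! ### Balanced partitions for two agents -/

/-- The sign with which an item on side `k` enters the difference of the two sides; items that are
not yet assigned are on side `0`. -/
def sgn (k : ℕ) : ℝ := if k = 1 then 1 else if k = 2 then -1 else 0

/-- A partial partition `σ` of the items `R` into the sides `1` and `2`, such that the sides differ
by at most `1` for each of the valuations `u` and `v`.  The items are assigned in the order of
decreasing `u`, which leaves room for the remaining ones. -/
structure Balanced (R : Finset ℕ) (u v : ℕ → ℝ) (σ : ℕ → ℕ) (du dv : ℝ) : Prop where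
  side_le : ∀ e ∈ R, σ e ≤ 2
  eq_u : du = ∑ e ∈ R, sgn (σ e) * u e
  eq_v : dv = ∑ e ∈ R, sgn (σ e) * v e
  abs_u : |du| ≤ 1
  abs_v : |dv| ≤ 1
  room : ∀ e ∈ R, σ e = 0 → |du| ≤ 1 - u e

/-- `c` is an unassigned item of `R` of maximum value `u`, or the dummy item `m` if there is
none. -/
def Pick (R : Finset ℕ) (u : ℕ → ℝ) (σ : ℕ → ℕ) (m c : ℕ) : Prop :=
  (c ∈ R ∧ σ c = 0 ∧ ∀ e ∈ R, σ e = 0 → u e ≤ u c) ∨ (c = m ∧ ∀ e ∈ R, σ e ≠ 0)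

theorem sum_sgn_update {R : Finset ℕ} {u : ℕ → ℝ} {σ : ℕ → ℕ} {c k : ℕ}
    (h : (c ∈ R ∧ σ c = 0) ∨ (c ∉ R ∧ u c = 0)) :
    ∑ e ∈ R, sgn (Function.update σ c k e) * u e = ∑ e ∈ R, sgn (σ e) * u e + sgn k * u c := by
  rcases h with ⟨hc, h0⟩ | ⟨hc, h0⟩
  · rw [← Finset.add_sum_erase R _ hc, ← Finset.add_sum_erase R (fun e => sgn (σ e) * u e) hc, h0]
    have : ∀ e ∈ R.erase c, sgn (Function.update σ c k e) * u e = sgn (σ e) * u e := by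
      intro e he
      rw [Function.update_of_ne (Finset.ne_of_mem_erase he)]
    rw [Finset.sum_congr rfl this]
    simp [sgn]
    ring
  · rw [h0, mul_zero, add_zero]
    refine Finset.sum_congr rfl fun e he => ?_
    rw [Function.update_of_ne (by rintro rfl; exact hc he)]

theorem Balanced.init {R : Finset ℕ} {u v : ℕ → ℝ} {σ : ℕ → ℕ} (hσ : ∀ e ∈ R, σ e = 0)
    (hu : ∀ e, u e ≤ 1) : Balanced R u v σ 0 0 where
  side_le e he := by simp [hσ e he]
  eq_u := (Finset.sum_eq_zero fun e he => by simp [hσ e he, sgn]).symm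
  eq_v := (Finset.sum_eq_zero fun e he => by simp [hσ e he, sgn]).symm
  abs_u := by simp
  abs_v := by simp
  room e _ _ := by simpa using hu e

/-- Two consecutive items are put on different sides. -/
theorem Balanced.step {R : Finset ℕ} {u v : ℕ → ℝ} {σ : ℕ → ℕ} {du dv : ℝ} {m c c' k k' : ℕ}
    (h : Balanced R u v σ du dv) (hm : m ∉ R) (hum : u m = 0) (hvm : v m = 0)
    (hu0 : ∀ e, 0 ≤ u e)
    (hc : Pick R u σ m c) (hc' : Pick R u (Function.update σ c 1) m c')
    (hk : (k = 1 ∧ k' = 2) ∨ (k = 2 ∧ k' = 1)) (hdv : |dv + sgn k * (v c - v c')| ≤ 1) :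
    Balanced R u v (Function.update (Function.update σ c k) c' k')
      (du + sgn k * (u c - u c')) (dv + sgn k * (v c - v c')) := by
  have hkk : sgn k' = - sgn k := by rcases hk with ⟨rfl, rfl⟩ | ⟨rfl, rfl⟩ <;> simp [sgn]
  have hk0 : k ≠ 0 ∧ k' ≠ 0 ∧ k ≤ 2 ∧ k' ≤ 2 := by omega
  have hcases : ∀ {w : ℕ → ℝ}, w m = 0 → ((c ∈ R ∧ σ c = 0) ∨ (c ∉ R ∧ w c = 0)) ∧
      ((c' ∈ R ∧ Function.update σ c k c' = 0) ∨ (c' ∉ R ∧ w c' = 0)) := by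
    intro w hw
    refine ⟨?_, ?_⟩
    · rcases hc with ⟨h1, h2, -⟩ | ⟨rfl, -⟩
      · exact Or.inl ⟨h1, h2⟩
      · exact Or.inr ⟨hm, hw⟩
    · rcases hc' with ⟨h1, h2, -⟩ | ⟨rfl, -⟩
      · refine Or.inl ⟨h1, ?_⟩
        have : c' ≠ c := by rintro rfl; simp at h2
        rwa [Function.update_of_ne this] at h2 ⊢
      · exact Or.inr ⟨hm, hw⟩
  have hun : ∀ e ∈ R, Function.update (Function.update σ c k) c' k' e = 0 →
      σ e = 0 ∧ e ≠ c ∧ e ≠ c' := by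
    intro e he h0
    have h1 : e ≠ c' := by rintro rfl; simp at h0; omega
    rw [Function.update_of_ne h1] at h0
    have h2 : e ≠ c := by rintro rfl; simp at h0; omega
    rw [Function.update_of_ne h2] at h0
    exact ⟨h0, h2, h1⟩
  -- the new difference is at most `1 - u c'`
  have habs : ∀ y, 0 ≤ u c - y → |du| ≤ 1 - u c → |du + sgn k * (u c - y)| ≤ 1 - y := by
    intro y hy hd
    have h1 : |sgn k * (u c - y)| = u c - y := by
      rcases hk with ⟨rfl, rfl⟩ | ⟨rfl, rfl⟩ <;> simp [sgn, abs_of_nonneg hy]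
      rw [abs_sub_comm, abs_of_nonneg hy]
    have h2 := abs_add_le du (sgn k * (u c - y))
    linarith
  have hle : ∀ e ∈ R, σ e = 0 → |du + sgn k * (u c - u c')| ≤ 1 - u c' := by
    intro e he h0
    rcases hc with ⟨h1, h2, h3⟩ | ⟨rfl, h3⟩
    · refine habs _ ?_ (h.room c h1 h2)
      rcases hc' with ⟨h4, h5, -⟩ | ⟨rfl, -⟩
      · have : c' ≠ c := by rintro rfl; simp at h5
        rw [Function.update_of_ne this] at h5
        linarith [h3 c' h4 h5]
      · linarith [hu0 c]
    · exact absurd h0 (h3 e he)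
  refine ⟨?_, ?_, ?_, ?_, hdv, ?_⟩
  · intro e he
    by_cases h1 : e = c'
    · subst h1; simp; omega
    · rw [Function.update_of_ne h1]
      by_cases h2 : e = c
      · subst h2; simp; omega
      · rw [Function.update_of_ne h2]; exact h.side_le e he
  · rw [sum_sgn_update (hcases hum).2, sum_sgn_update (hcases hum).1, ← h.eq_u, hkk]; ring
  · rw [sum_sgn_update (hcases hvm).2, sum_sgn_update (hcases hvm).1, ← h.eq_v, hkk]; ring
  · rcases hc with ⟨h1, h2, h3⟩ | ⟨rfl, h3⟩
    · exact (hle c h1 h2).trans (by linarith [hu0 c'])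
    · rcases hc' with ⟨h4, h5, -⟩ | ⟨rfl, -⟩
      · have : c' ≠ c := by rintro rfl; exact hm h4
        rw [Function.update_of_ne this] at h5
        exact absurd h5 (h3 c' h4)
      · simpa using h.abs_u
  · intro e he h0
    obtain ⟨h1, h2, h3⟩ := hun e he h0
    have h4 := hle e he h1
    rcases hc' with ⟨h5, h6, h7⟩ | ⟨rfl, h7⟩
    · have := h7 e he (by rwa [Function.update_of_ne h2])
      linarith
    · exact absurd h1 (by simpa [Function.update_of_ne h2] using h7 e he)

/-- At least one item is newly assigned in each step; so as many steps as there are items suffice.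
-/
theorem card_unassigned_step {R : Finset ℕ} {u : ℕ → ℝ} {σ : ℕ → ℕ} {m c c' k k' N : ℕ}
    (hc : Pick R u σ m c) (hm : m ∉ R) (hk : k ≠ 0) (hk' : k' ≠ 0)
    (hN : (R.filter fun e => σ e = 0).card ≤ N) :
    (R.filter fun e => Function.update (Function.update σ c k) c' k' e = 0).card ≤ N - 1 := by
  have hsub : (R.filter fun e => Function.update (Function.update σ c k) c' k' e = 0) ⊆
      (R.filter fun e => σ e = 0).erase c := by
    intro e he
    simp only [Finset.mem_filter, Finset.mem_erase] at he ⊢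
    obtain ⟨h1, h2⟩ := he
    have h3 : e ≠ c' := by rintro rfl; simp at h2; omega
    rw [Function.update_of_ne h3] at h2
    have h4 : e ≠ c := by rintro rfl; simp at h2; omega
    rw [Function.update_of_ne h4] at h2
    exact ⟨h4, h1, h2⟩
  have h1 := Finset.card_le_card hsub
  rcases hc with ⟨h2, h3, -⟩ | ⟨rfl, h3⟩
  · rw [Finset.card_erase_of_mem (by simp [h2, h3])] at h1
    omega
  · have : (R.filter fun e => σ e = 0) = ∅ := by
      rw [Finset.filter_eq_empty_iff]; exact fun e he => h3 e he
    rw [this] at h1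
    simp only [Finset.erase_empty, Finset.card_empty] at h1
    omega

/-! ### The tables of the program -/

/-!
Tables of natural numbers: for each item `e`, `tblOwner` holds the final owner, `tblCross` the
owner in the split that disregards favourites, and `tblSide` the side of `e` in the partition
under construction, all in row `0`.  For each agent `l`, row `0` of `tblFav`, `tblPt`, `tblMove`
and `tblBest` holds the favourite edge, its other endpoint, whether `t l` is to take this edge if
she is active, and the best child.  Row `l` of `tblTake` and of `tblKeep` holds the owners of the
items between `l` and the agent she points to, in case her favourite is taken or not.  Row `k` of
`tblAct` marks the agents reached by chains after `k` rounds.  The other names stand for scalar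
variables.

Tables of reals: `tblPay` is the output, `varDiffA` and `varDiffB` are the differences of the two
sides for the agents in `varA` and `varB`, row `i` of `tblVal` holds the values of the bundles for
agent `i`, and row `k` of `tblRound` the payments after `k` rounds.

The numbers are written as notations, so that distinct tables are distinct numerals.
-/

notation "tblOwner" => (0 : ℕ)
notation "tblFav" => (1 : ℕ)
notation "tblPt" => (2 : ℕ)
notation "tblMove" => (3 : ℕ)
notation "tblBest" => (4 : ℕ)
notation "tblAct" => (5 : ℕ)
notation "tblTake" => (6 : ℕ)
notation "tblKeep" => (7 : ℕ)
notation "tblCross" => (8 : ℕ)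
notation "tblSide" => (9 : ℕ)
notation "varFst" => (10 : ℕ)
notation "varSnd" => (11 : ℕ)
notation "varPart" => (12 : ℕ)
notation "varOther" => (13 : ℕ)
notation "varA" => (14 : ℕ)
notation "varB" => (15 : ℕ)
notation "varSkip" => (16 : ℕ)
notation "varI" => (20 : ℕ)
notation "varJ" => (21 : ℕ)
notation "varK" => (22 : ℕ)
notation "varE" => (23 : ℕ)
notation "tblPay" => (0 : ℕ)
notation "varDiffA" => (1 : ℕ)
notation "varDiffB" => (2 : ℕ)
notation "tblVal" => (3 : ℕ)
notation "tblRound" => (4 : ℕ)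

/-- An entry of row `0` of a table. -/
@[reducible] def entry (a : ℕ) (j : NatExpr) : NatExpr := .cell a (.const 0) j

/-- Assignment to an entry of row `0` of a table. -/
@[reducible] def setEntry (a : ℕ) (j x : NatExpr) : RamProg := .setNat a (.const 0) j x

/-! ### The program for balanced partitions -/

/-- The properties of the machine input of an instance with normalized additive valuations.  By
`value_out`, the number `numItems` can serve as a dummy item of value `0`. -/
structure Valid (X : RamInput) : Prop where
  endA_lt : ∀ e < X.numItems, X.endA e < X.numAgents
  endB_lt : ∀ e < X.numItems, X.endB e < X.numAgents
  endA_ne_endB : ∀ e < X.numItems, X.endA e ≠ X.endB e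
  value_nonneg : ∀ i e, 0 ≤ X.value i e
  value_le : ∀ i e, X.value i e ≤ 1
  value_out : ∀ i e, X.numItems ≤ e → X.value i e = 0
  value_local : ∀ i, ∀ e < X.numItems, X.endA e ≠ i → X.endB e ≠ i → X.value i e = 0
  exists_fav : ∀ i < X.numAgents, ∃ e < X.numItems, 1 ≤ X.value i e

/-- Item `e` joins the agents `a` and `b`. -/
def Joins (X : RamInput) (a b e : ℕ) : Prop :=
  (X.endA e = a ∧ X.endB e = b) ∨ (X.endA e = b ∧ X.endB e = a)

open Classical in
/-- The items between `a` and `b`. -/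
noncomputable def between (X : RamInput) (a b : ℕ) : Finset ℕ :=
  (Finset.range X.numItems).filter (Joins X a b)

theorem mem_between {X : RamInput} {a b e : ℕ} :
    e ∈ between X a b ↔ e < X.numItems ∧ Joins X a b e := by
  simp [between]

theorem between_comm (X : RamInput) (a b : ℕ) : between X a b = between X b a := by
  ext e; simp only [mem_between, Joins]; tauto

/-- The test whether an item joins the agents in `varA` and `varB` and is not the one in
`varSkip`. -/
def inPair (e : NatExpr) : RamTest :=
  .and (.not (eqTest e (var varSkip)))
    (orTest (.and (eqTest (.endA e) (var varA)) (eqTest (.endB e) (var varB)))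
      (.and (eqTest (.endA e) (var varB)) (eqTest (.endB e) (var varA))))

@[simp] theorem holds_inPair {X : RamInput} {s : RamState} {e : NatExpr} :
    (inPair e).Holds X s ↔ e.eval X s ≠ s.nat varSkip 0 0 ∧
      Joins X (s.nat varA 0 0) (s.nat varB 0 0) (e.eval X s) := by
  simp [inPair, Joins]

/-- Find the unassigned item that is worth most to the agent in `varA`; if no item is left, the
result is the dummy item. -/
def pickProg (c : ℕ) : RamProg :=
  .seq (setVar c .numItems) <|
    forLoop varE .numItems <|
      .ite (.and (inPair (var varE)) (.and (.natLe (entry tblSide (var varE)) (.const 0))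
          (.realLe (.value (var varA) (var c)) (.value (var varA) (var varE)))))
        (setVar c (var varE)) .skip

theorem runs_pickProg {X : RamInput} (hX : Valid X) {c : ℕ} (hc : c = varFst ∨ c = varSnd)
    (s : RamState) :
    Runs X (pickProg c) s fun s' =>
      Pick ((between X (s.nat varA 0 0) (s.nat varB 0 0)).erase (s.nat varSkip 0 0))
        (X.value (s.nat varA 0 0)) (s.nat tblSide 0) X.numItems (s'.nat c 0 0) := by
  have hw : c ≠ tblSide ∧ c ≠ varA ∧ c ≠ varB ∧ c ≠ varSkip ∧ c ≠ varE := by omega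
  obtain ⟨w1, w2, w3, w4, w5⟩ := hw
  refine .seq (.setNat ?_)
  simp only [NatExpr.eval]
  refine .forLoop X.numItems (fun k s' => (s'.nat c 0 0 = X.numItems ∧
      ∀ e < k, Joins X (s.nat varA 0 0) (s.nat varB 0 0) e → e ≠ s.nat varSkip 0 0 →
        s.nat tblSide 0 e ≠ 0) ∨
    (s'.nat c 0 0 < X.numItems ∧ Joins X (s.nat varA 0 0) (s.nat varB 0 0) (s'.nat c 0 0) ∧
      s'.nat c 0 0 ≠ s.nat varSkip 0 0 ∧ s.nat tblSide 0 (s'.nat c 0 0) = 0 ∧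
      ∀ e < k, Joins X (s.nat varA 0 0) (s.nat varB 0 0) e → e ≠ s.nat varSkip 0 0 →
        s.nat tblSide 0 e = 0 →
          X.value (s.nat varA 0 0) e ≤ X.value (s.nat varA 0 0) (s'.nat c 0 0)))
    (by omega) (fun _ => rfl) (by simp [writesNat, w5.symm]) ?_ ?_ ?_ ?_
  · intro k s' x h
    simpa [w5] using h
  · left; simp
  · intro k hk s' ha hkc hI
    have key : ∀ a, a ≠ c → a ≠ varE → s'.nat a = s.nat a := by
      intro a h1 h2
      rw [ha.nat a (by simp [forLoop, writesNat, h1, h2]), writeNat_nat_of_ne _ _ _ _ h1]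
    have kA := key varA (Ne.symm w2) (by norm_num)
    have kB := key varB (Ne.symm w3) (by norm_num)
    have kS := key varSkip (Ne.symm w4) (by norm_num)
    have kT := key tblSide (Ne.symm w1) (by norm_num)
    refine .ite (fun ht => .setNat ?_) (fun ht => .skip ?_)
    · simp only [holds_and, holds_inPair, NatExpr.eval, hkc, kA, kB, kS, kT, holds_natLe,
        holds_realLe, RealExpr.eval, nonpos_iff_eq_zero] at ht
      obtain ⟨⟨t1, t2⟩, t3, t4⟩ := ht
      right
      simp only [NatExpr.eval, hkc, writeNat_nat, and_self, if_true]
      refine ⟨hk, t2, t1, t3, fun e he h1 h2 h3 => ?_⟩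
      rcases Nat.lt_succ_iff_lt_or_eq.1 he with he | rfl
      · rcases hI with ⟨-, hI⟩ | ⟨-, -, -, -, hI⟩
        · exact absurd h3 (hI e he h1 h2)
        · exact (hI e he h1 h2 h3).trans t4
      · exact le_rfl
    · simp only [holds_and, holds_inPair, NatExpr.eval, hkc, kA, kB, kS, kT, holds_natLe,
        holds_realLe, RealExpr.eval, nonpos_iff_eq_zero] at ht
      rcases hI with ⟨h0, hI⟩ | ⟨h1, h2, h3, h4, hI⟩
      · refine Or.inl ⟨h0, fun e he h1 h2 h3 => ?_⟩
        rcases Nat.lt_succ_iff_lt_or_eq.1 he with he | rfl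
        · exact hI e he h1 h2 h3
        · refine ht ⟨⟨h2, h1⟩, h3, ?_⟩
          rw [h0, hX.value_out _ _ le_rfl]
          exact hX.value_nonneg _ _
      · refine Or.inr ⟨h1, h2, h3, h4, fun e he h5 h6 h7 => ?_⟩
        rcases Nat.lt_succ_iff_lt_or_eq.1 he with he | rfl
        · exact hI e he h5 h6 h7
        · by_contra hlt
          exact ht ⟨⟨h6, h5⟩, h7, le_of_not_ge hlt⟩
  · intro s' ha hI
    rcases hI with ⟨h0, hI⟩ | ⟨h1, h2, h3, h4, hI⟩
    · refine Or.inr ⟨h0, fun e he => ?_⟩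
      obtain ⟨h1, h2⟩ := Finset.mem_erase.1 he
      rw [mem_between] at h2
      exact hI e h2.1 h2.2 h1
    · refine Or.inl ⟨Finset.mem_erase.2 ⟨h3, mem_between.2 ⟨h1, h2⟩⟩, h4, fun e he => ?_⟩
      obtain ⟨h1, h2⟩ := Finset.mem_erase.1 he
      rw [mem_between] at h2
      exact hI e h2.1 h2.2 h1

/-- Put the two unassigned items that are worth most to the agent in `varA` on different sides, in
the way that keeps the difference of the sides for the agent in `varB` within `[-1, 1]`. -/
def balanceStep : RamProg :=
  .seq (pickProg varFst) <|
  .seq (setEntry tblSide (var varFst) (.const 1)) <|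
  .seq (pickProg varSnd) <|
  .ite (.and
      (.realLe (.add (rvar varDiffB)
        (.sub (.value (var varB) (var varFst)) (.value (var varB) (var varSnd)))) .one)
      (.realLe (.sub .zero .one) (.add (rvar varDiffB)
        (.sub (.value (var varB) (var varFst)) (.value (var varB) (var varSnd))))))
    (.seq (setEntry tblSide (var varFst) (.const 1)) <|
      .seq (setEntry tblSide (var varSnd) (.const 2)) <|
      .seq (setRvar varDiffA (.add (rvar varDiffA)
        (.sub (.value (var varA) (var varFst)) (.value (var varA) (var varSnd)))))
      (setRvar varDiffB (.add (rvar varDiffB)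
        (.sub (.value (var varB) (var varFst)) (.value (var varB) (var varSnd))))))
    (.seq (setEntry tblSide (var varFst) (.const 2)) <|
      .seq (setEntry tblSide (var varSnd) (.const 1)) <|
      .seq (setRvar varDiffA (.sub (rvar varDiffA)
        (.sub (.value (var varA) (var varFst)) (.value (var varA) (var varSnd)))))
      (setRvar varDiffB (.sub (rvar varDiffB)
        (.sub (.value (var varB) (var varFst)) (.value (var varB) (var varSnd))))))

/-- Compute a balanced partition, for the agents in `varA` and `varB`, of the items between them
other than the one in `varSkip`. -/
def balanceProg : RamProg :=
  .seq (forLoop varE .numItems (setEntry tblSide (var varE) (.const 0))) <|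
  .seq (setRvar varDiffA .zero) <|
  .seq (setRvar varDiffB .zero) <|
  forLoop varK .numItems balanceStep

/-- The items that are to be partitioned. -/
noncomputable def items (X : RamInput) (s : RamState) : Finset ℕ :=
  (between X (s.nat varA 0 0) (s.nat varB 0 0)).erase (s.nat varSkip 0 0)

theorem numItems_notMem_items (X : RamInput) (s : RamState) : X.numItems ∉ items X s := by
  simp [items, mem_between]

theorem runs_balanceStep {X : RamInput} (hX : Valid X) (s : RamState) (N : ℕ)
    (hB : Balanced (items X s) (X.value (s.nat varA 0 0)) (X.value (s.nat varB 0 0))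
      (s.nat tblSide 0) (s.real varDiffA 0 0) (s.real varDiffB 0 0))
    (hN : ((items X s).filter fun e => s.nat tblSide 0 e = 0).card ≤ N) :
    Runs X balanceStep s fun s' =>
      Balanced (items X s) (X.value (s.nat varA 0 0)) (X.value (s.nat varB 0 0))
        (s'.nat tblSide 0) (s'.real varDiffA 0 0) (s'.real varDiffB 0 0) ∧
      ((items X s).filter fun e => s'.nat tblSide 0 e = 0).card ≤ N - 1 := by
  set u := X.value (s.nat varA 0 0) with hu
  set v := X.value (s.nat varB 0 0) with hv
  set R := items X s with hR
  refine .seq ((runs_pickProg hX (Or.inl rfl) s).imp_agree fun s1 h1 a1 => ?_)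
  refine .seq (.setNat ?_)
  simp only [NatExpr.eval]
  set c := s1.nat varFst 0 0 with hc
  set s2 := s1.writeNat tblSide 0 c 1 with hs2
  have s2n : ∀ a, a ≠ tblSide → a ≠ varFst → a ≠ varE → s2.nat a = s.nat a := fun a h2 h3 h4 => by
    rw [hs2, writeNat_nat_of_ne _ _ _ _ h2,
      a1.nat a (by simp [pickProg, forLoop, writesNat, h3, h4])]
  have s2s : s2.nat tblSide 0 = Function.update (s.nat tblSide 0) c 1 := by
    rw [hs2, writeNat_row, a1.nat tblSide rfl]
  have s2r : s2.real = s.real := by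
    funext a; exact a1.real a rfl
  refine .seq ((runs_pickProg hX (Or.inr rfl) s2).imp_agree fun s3 h3 a3 => ?_)
  rw [s2n varA (by decide) (by decide) (by decide), s2n varB (by decide) (by decide) (by decide),
    s2n varSkip (by decide) (by decide) (by decide), s2s] at h3
  set c' := s3.nat varSnd 0 0 with hc'
  have e1 : s3.nat varFst 0 0 = c := by
    rw [a3.nat varFst rfl, hs2, writeNat_nat]; simp [hc]
  have e2 : s3.nat varA 0 0 = s.nat varA 0 0 := by
    rw [a3.nat varA rfl, s2n varA (by decide) (by decide) (by decide)]
  have e3 : s3.nat varB 0 0 = s.nat varB 0 0 := by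
    rw [a3.nat varB rfl, s2n varB (by decide) (by decide) (by decide)]
  have e4 : s3.nat tblSide 0 = Function.update (s.nat tblSide 0) c 1 := by
    rw [a3.nat tblSide rfl, s2s]
  have e5 : s3.real = s.real := by
    funext a; rw [a3.real a rfl, s2r]
  have hpos : ∀ e, 0 ≤ v e ∧ v e ≤ 1 := fun e => ⟨hX.value_nonneg _ _, hX.value_le _ _⟩
  have hdv := abs_le.1 hB.abs_v
  have side : ∀ k k', Function.update (Function.update (s3.nat tblSide 0) c k) c' k' =
      Function.update (Function.update (s.nat tblSide 0) c k) c' k' := by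
    intro k k'
    rw [e4, Function.update_idem]
  have hstep : ∀ k k', (k = 1 ∧ k' = 2) ∨ (k = 2 ∧ k' = 1) →
      |s.real varDiffB 0 0 + sgn k * (v c - v c')| ≤ 1 → ∀ s4 : RamState,
      s4.nat tblSide 0 = Function.update (Function.update (s3.nat tblSide 0) c k) c' k' →
      s4.real varDiffA 0 0 = s.real varDiffA 0 0 + sgn k * (u c - u c') →
      s4.real varDiffB 0 0 = s.real varDiffB 0 0 + sgn k * (v c - v c') →
      Balanced R u v (s4.nat tblSide 0) (s4.real varDiffA 0 0) (s4.real varDiffB 0 0) ∧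
        (R.filter fun e => s4.nat tblSide 0 e = 0).card ≤ N - 1 := by
    intro k k' hk hd s4 h5 h6 h7
    rw [h5, h6, h7, side]
    exact ⟨hB.step (numItems_notMem_items X s) (hX.value_out _ _ le_rfl)
      (hX.value_out _ _ le_rfl) (hX.value_nonneg _) h1 h3 hk hd,
      card_unassigned_step h1 (numItems_notMem_items X s) (by omega) (by omega) hN⟩
  refine .ite (fun ht => ?_) (fun ht => ?_)
  · simp only [holds_and, holds_realLe, RealExpr.eval, NatExpr.eval, e1, e3, e5, ← hc'] at ht
    have hd : |s.real varDiffB 0 0 + sgn 1 * (v c - v c')| ≤ 1 := by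
      rw [abs_le]; simp only [sgn, if_true, one_mul]; constructor <;> linarith [ht.1, ht.2]
    refine .seq (.setNat (.seq (.setNat (.seq (.setReal (.setReal ?_))))))
    refine hstep 1 2 (Or.inl ⟨rfl, rfl⟩) hd _ ?_ ?_ ?_ <;>
      simp [writeNat_row, e1, e2, e3, e5, ← hc', ← hu, ← hv, sgn]
  · simp only [holds_and, holds_realLe, RealExpr.eval, NatExpr.eval, e1, e3, e5, ← hc'] at ht
    have hd : |s.real varDiffB 0 0 + sgn 2 * (v c - v c')| ≤ 1 := by
      have h0 := hpos c
      have h0' := hpos c'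
      have hs : sgn 2 = -1 := by simp [sgn]
      rw [abs_le, hs]
      by_cases hle : s.real varDiffB 0 0 + (v c - v c') ≤ 1
      · have : ¬ (0 - 1 ≤ s.real varDiffB 0 0 + (v c - v c')) := fun h => ht ⟨hle, h⟩
        constructor <;> linarith
      · constructor <;> linarith
    refine .seq (.setNat (.seq (.setNat (.seq (.setReal (.setReal ?_))))))
    refine hstep 2 1 (Or.inr ⟨rfl, rfl⟩) hd _ ?_ ?_ ?_ <;>
      simp [writeNat_row, e1, e2, e3, e5, ← hc', ← hu, ← hv, sgn, sub_eq_add_neg]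

theorem runs_balanceProg {X : RamInput} (hX : Valid X) (s : RamState) :
    Runs X balanceProg s fun s' =>
      Balanced (items X s) (X.value (s.nat varA 0 0)) (X.value (s.nat varB 0 0))
        (s'.nat tblSide 0) (s'.real varDiffA 0 0) (s'.real varDiffB 0 0) ∧
      ∀ e ∈ items X s, s'.nat tblSide 0 e ≠ 0 := by
  refine .seq (.forLoop X.numItems (fun k s' => ∀ e < k, s'.nat tblSide 0 e = 0) (by omega)
    (fun _ => rfl) rfl (fun k s' x h => by simpa using h) (by simp) ?_ ?_)
  · intro k hk s' ha hkc hI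
    refine .setNat ?_
    intro e he
    by_cases hek : e = k
    · simp [hek, hkc]
    · simpa [hkc, hek] using hI e (by omega)
  intro s1 a1 h1
  refine .seq (.setReal (.seq (.setReal ?_)))
  refine .forLoop X.numItems (fun k s' =>
      Balanced (items X s) (X.value (s.nat varA 0 0)) (X.value (s.nat varB 0 0))
        (s'.nat tblSide 0) (s'.real varDiffA 0 0) (s'.real varDiffB 0 0) ∧
      ((items X s).filter fun e => s'.nat tblSide 0 e = 0).card ≤ X.numItems - k) (by omega)
    (fun _ => rfl) rfl (fun k s' x h => by simpa [writeNat_nat_of_ne] using h) ?_ ?_ ?_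
  · have h0 : ∀ e ∈ items X s, s1.nat tblSide 0 e = 0 := fun e he =>
      h1 e (mem_between.1 (Finset.mem_of_mem_erase he)).1
    refine ⟨by simpa using Balanced.init h0 (hX.value_le _), ?_⟩
    refine (Finset.card_filter_le _ _).trans ?_
    have : items X s ⊆ Finset.range X.numItems := fun e he =>
      Finset.mem_range.2 (mem_between.1 (Finset.mem_of_mem_erase he)).1
    simpa using Finset.card_le_card this
  · intro k hk s' ha hkc ⟨hI1, hI2⟩
    have key : ∀ a, writesNat a balanceStep = false → a ≠ varK → a ≠ varE →
        s'.nat a = s.nat a := by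
      intro a h2 h3 h4
      rw [ha.nat a (by simp [forLoop, writesNat, h2, h3])]
      exact a1.nat a (by
        have : a ≠ tblSide := by rintro rfl; exact absurd h2 (by decide)
        simp [forLoop, writesNat, this, h4])
    have kA := key varA rfl (by decide) (by decide)
    have kB := key varB rfl (by decide) (by decide)
    have kS := key varSkip rfl (by decide) (by decide)
    have hit : items X s' = items X s := by rw [items, items, kA, kB, kS]
    rw [← hit, ← kA, ← kB] at hI1 ⊢
    rw [← hit] at hI2
    exact (runs_balanceStep hX s' _ hI1 hI2).imp fun s'' h => ⟨h.1, by omega⟩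
  · intro s' ha ⟨hI1, hI2⟩
    refine ⟨hI1, fun e he h0 => ?_⟩
    rw [Nat.sub_self, Nat.le_zero, Finset.card_eq_zero, Finset.filter_eq_empty_iff] at hI2
    exact hI2 he h0

/-! ### Favourite edges -/

/-- Find the favourite edge of every agent and the other endpoint of this edge. -/
def favProg : RamProg :=
  forLoop varI .numAgents <|
    .seq (forLoop varE .numItems <|
      .ite (.realLe .one (.value (var varI) (var varE)))
        (setEntry tblFav (var varI) (var varE)) .skip) <|
    .ite (eqTest (.endA (entry tblFav (var varI))) (var varI))
      (setEntry tblPt (var varI) (.endB (entry tblFav (var varI))))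
      (setEntry tblPt (var varI) (.endA (entry tblFav (var varI))))

/-- `f` is the favourite edge of the agent `l`, and `t` its other endpoint. -/
def IsFav (X : RamInput) (l t f : ℕ) : Prop :=
  f < X.numItems ∧ 1 ≤ X.value l f ∧ Joins X t l f

theorem runs_favProg {X : RamInput} (hX : Valid X) (s : RamState) :
    Runs X favProg s fun s' => ∀ l < X.numAgents,
      IsFav X l (s'.nat tblPt 0 l) (s'.nat tblFav 0 l) := by
  refine .forLoop X.numAgents (fun k s' => ∀ l < k,
      IsFav X l (s'.nat tblPt 0 l) (s'.nat tblFav 0 l)) (by omega) (fun _ => rfl) rfl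
    (fun k s' x h => by simpa [writeNat_nat_of_ne] using h) (by simp) ?_ (fun _ _ h => h)
  intro i hi s' _ hki hI
  obtain ⟨e₀, he₀, hv₀⟩ := hX.exists_fav i hi
  refine .seq (.forLoop X.numItems (fun k s'' => (∀ l, l ≠ i →
        s''.nat tblFav 0 l = s'.nat tblFav 0 l) ∧ ((∃ e < k, 1 ≤ X.value i e) →
        s''.nat tblFav 0 i < X.numItems ∧ 1 ≤ X.value i (s''.nat tblFav 0 i))) (by omega)
    (fun _ => rfl) rfl (fun k s' x h => by simpa [writeNat_nat_of_ne] using h) (by simp) ?_ ?_)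
  · intro k hk s'' ha hkc ⟨h1, h2⟩
    have hi'' : s''.nat varI 0 0 = i := by rw [ha.nat varI rfl, hki]
    refine .ite (fun ht => .setNat ?_) (fun ht => .skip ⟨h1, ?_⟩)
    · simp only [holds_realLe, RealExpr.eval, NatExpr.eval, hi'', hkc] at ht
      refine ⟨fun l hl => ?_, fun _ => ?_⟩
      · simpa [hi'', hkc, hl] using h1 l hl
      · simpa [hi'', hkc] using ⟨hk, ht⟩
    · simp only [holds_realLe, RealExpr.eval, NatExpr.eval, hi'', hkc] at ht
      rintro ⟨e, he, hv⟩
      rcases Nat.lt_succ_iff_lt_or_eq.1 he with he | rfl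
      · exact h2 ⟨e, he, hv⟩
      · exact absurd hv ht
  intro s'' ha ⟨h1, h2⟩
  obtain ⟨h3, h4⟩ := h2 ⟨e₀, he₀, hv₀⟩
  have hi'' : s''.nat varI 0 0 = i := by rw [ha.nat varI rfl, hki]
  have hpt : s''.nat tblPt = s'.nat tblPt := ha.nat tblPt rfl
  have hinc : X.endA (s''.nat tblFav 0 i) = i ∨ X.endB (s''.nat tblFav 0 i) = i := by
    by_contra! hne
    rw [hX.value_local i _ h3 hne.1 hne.2] at h4
    linarith
  have done : ∀ y, Joins X y i (s''.nat tblFav 0 i) → ∀ l < i + 1,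
      IsFav X l ((s''.writeNat tblPt 0 i y).nat tblPt 0 l)
        ((s''.writeNat tblPt 0 i y).nat tblFav 0 l) := by
    intro y hy l hl
    rcases Nat.lt_succ_iff_lt_or_eq.1 hl with hl | rfl
    · simpa [Nat.ne_of_lt hl, h1 l (Nat.ne_of_lt hl), hpt] using hI l hl
    · simpa using ⟨h3, h4, hy⟩
  refine .ite (fun ht => .setNat ?_) (fun ht => .setNat ?_) <;>
    simp only [holds_eq, NatExpr.eval, hi''] at ht ⊢
  · exact done _ (Or.inr ⟨ht, rfl⟩)
  · exact done _ (Or.inl ⟨rfl, hinc.resolve_left ht⟩)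

/-! ### The two ways to split the edges between an agent and the one she points to -/

/-- The items between `a` and `l` other than the favourite item `f` of `l` are split into `P`, which
`l` prefers, and `Q`.  The function `take` gives the owners of the items if `a` takes `f`, and
`keep` if `l` keeps `f`; `move` says that `a` is to take `f` if she needs to. -/
structure ChildSplit (X : RamInput) (a l f : ℕ) (P Q : Finset ℕ) (move : Prop)
    (take keep : ℕ → ℕ) : Prop where
  disj : Disjoint P Q
  union : P ∪ Q = (between X a l).erase f
  pl_le : ∑ e ∈ P, X.value a e ≤ ∑ e ∈ Q, X.value a e + 1
  qc_le : ∑ e ∈ Q, X.value l e ≤ ∑ e ∈ P, X.value l e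
  pc_le : ∑ e ∈ P, X.value l e ≤ ∑ e ∈ Q, X.value l e + 1
  move_iff : move ↔ 1 - X.value a f < ∑ e ∈ P, X.value a e - ∑ e ∈ Q, X.value a e ∧
    ∑ e ∈ P, X.value a e - ∑ e ∈ Q, X.value a e + 1 - X.value a f <
      ∑ e ∈ P, X.value l e - ∑ e ∈ Q, X.value l e
  take_eq : ∀ e ∈ between X a l, take e = if e ∈ P then l else a
  keep_eq : (X.value a f + ∑ e ∈ P, X.value a e ≤ 1 + ∑ e ∈ Q, X.value a e ∧
      ∀ e ∈ between X a l, keep e = if e ∈ Q then a else l) ∨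
    (1 + ∑ e ∈ Q, X.value a e < X.value a f + ∑ e ∈ P, X.value a e ∧
      ∀ e ∈ between X a l, keep e = if e ∈ P then a else l)

theorem sum_sgn_eq {R : Finset ℕ} {σ : ℕ → ℕ} (u : ℕ → ℝ) (h : ∀ e ∈ R, σ e ≤ 2) :
    ∑ e ∈ R, sgn (σ e) * u e =
      ∑ e ∈ R.filter (fun e => σ e = 1), u e - ∑ e ∈ R.filter (fun e => σ e = 2), u e := by
  rw [Finset.sum_filter, Finset.sum_filter, ← Finset.sum_sub_distrib]
  refine Finset.sum_congr rfl fun e he => ?_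
  have := h e he
  interval_cases σ e <;> simp [sgn]

/-- Row `varI` of table `tbl` records the owner `x` for the items on side `k`, except the one in
`varSkip`, and the owner `y` for the other items. -/
def dealProg (tbl k x y : ℕ) : RamProg :=
  forLoop varE .numItems <|
    .ite (.and (.not (eqTest (var varE) (var varSkip))) (eqTest (entry tblSide (var varE)) (var k)))
      (.setNat tbl (var varI) (var varE) (var x)) (.setNat tbl (var varI) (var varE) (var y))

theorem runs_dealProg {X : RamInput} {tbl k x y : ℕ} (s : RamState)
    (ht : tbl = tblTake ∨ tbl = tblKeep) (hk : k = varPart ∨ k = varOther)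
    (hx : x = varA ∨ x = varB) (hy : y = varA ∨ y = varB) :
    Runs X (dealProg tbl k x y) s fun s' =>
      (∀ i, i ≠ s.nat varI 0 0 → s'.nat tbl i = s.nat tbl i) ∧
      ∀ e < X.numItems, s'.nat tbl (s.nat varI 0 0) e =
        if e ≠ s.nat varSkip 0 0 ∧ s.nat tblSide 0 e = s.nat k 0 0 then s.nat x 0 0
        else s.nat y 0 0 := by
  have htE : tbl ≠ varE := by omega
  refine .forLoop X.numItems (fun j s' => (∀ i, i ≠ s.nat varI 0 0 → s'.nat tbl i = s.nat tbl i) ∧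
      ∀ e < j, s'.nat tbl (s.nat varI 0 0) e =
        if e ≠ s.nat varSkip 0 0 ∧ s.nat tblSide 0 e = s.nat k 0 0 then s.nat x 0 0
        else s.nat y 0 0) (by omega) (fun _ => rfl) ?_
    (fun k s' x h => by simpa [writeNat_nat_of_ne, htE] using h) (by simp) ?_ (fun _ _ h => h)
  · simp [writesNat]; omega
  intro j hj s' ha hjc ⟨h1, h2⟩
  have key : ∀ a, a ≠ tbl → a ≠ varE → s'.nat a = s.nat a := fun a h3 h4 =>
    ha.nat a (by simp [forLoop, writesNat, h3, h4])
  have kI := key varI (by omega) (by omega)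
  have kS := key varSkip (by omega) (by omega)
  have kT := key tblSide (by omega) (by omega)
  have kk := key k (by omega) (by omega)
  have kx := key x (by omega) (by omega)
  have ky := key y (by omega) (by omega)
  have done : ∀ z, z = (if j ≠ s.nat varSkip 0 0 ∧ s.nat tblSide 0 j = s.nat k 0 0 then s.nat x 0 0
        else s.nat y 0 0) →
      (∀ i, i ≠ s.nat varI 0 0 → (s'.writeNat tbl (s.nat varI 0 0) j z).nat tbl i = s.nat tbl i) ∧
      ∀ e < j + 1, (s'.writeNat tbl (s.nat varI 0 0) j z).nat tbl (s.nat varI 0 0) e =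
        if e ≠ s.nat varSkip 0 0 ∧ s.nat tblSide 0 e = s.nat k 0 0 then s.nat x 0 0
        else s.nat y 0 0 := by
    intro z hz
    refine ⟨fun i hi => ?_, fun e he => ?_⟩
    · rw [writeNat_row_of_ne _ _ _ (by tauto), h1 i hi]
    · rw [writeNat_row]
      rcases Nat.lt_succ_iff_lt_or_eq.1 he with he | rfl
      · rw [Function.update_of_ne (by omega), h2 e he]
      · rw [Function.update_self, hz]
  refine .ite (fun ht => .setNat ?_) (fun ht => .setNat ?_) <;>
    simp only [holds_and, holds_not, holds_eq, NatExpr.eval, hjc, kI, kS, kT, kk, kx, ky] at ht ⊢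
  · exact done _ (by rw [if_pos ht])
  · exact done _ (by rw [if_neg ht])

/-- Let `varPart` be the side that the agent in `varB` prefers. -/
def orderProg : RamProg :=
  .ite (.realLe .zero (rvar varDiffB))
    (.seq (setVar varPart (.const 1)) (setVar varOther (.const 2)))
    (.seq (setVar varPart (.const 2)) <| .seq (setVar varOther (.const 1)) <|
      .seq (setRvar varDiffA (.sub .zero (rvar varDiffA)))
        (setRvar varDiffB (.sub .zero (rvar varDiffB))))

theorem runs_orderProg {X : RamInput} (s : RamState) {R : Finset ℕ} {u v : ℕ → ℝ}
    (hB : Balanced R u v (s.nat tblSide 0) (s.real varDiffA 0 0) (s.real varDiffB 0 0))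
    (h0 : ∀ e ∈ R, s.nat tblSide 0 e ≠ 0) :
    Runs X orderProg s fun s' => ∃ P Q : Finset ℕ, Disjoint P Q ∧ P ∪ Q = R ∧
      P = R.filter (fun e => s.nat tblSide 0 e = s'.nat varPart 0 0) ∧
      Q = R.filter (fun e => s.nat tblSide 0 e = s'.nat varOther 0 0) ∧
      s'.real varDiffA 0 0 = ∑ e ∈ P, u e - ∑ e ∈ Q, u e ∧
      s'.real varDiffB 0 0 = ∑ e ∈ P, v e - ∑ e ∈ Q, v e ∧
      |s'.real varDiffA 0 0| ≤ 1 ∧ 0 ≤ s'.real varDiffB 0 0 ∧ s'.real varDiffB 0 0 ≤ 1 := by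
  have hu := hB.eq_u
  have hv := hB.eq_v
  rw [sum_sgn_eq _ hB.side_le] at hu hv
  have hdisj : Disjoint (R.filter fun e => s.nat tblSide 0 e = 1)
      (R.filter fun e => s.nat tblSide 0 e = 2) := by
    rw [Finset.disjoint_filter]
    intro e _ h1 h2
    omega
  have hunion : (R.filter fun e => s.nat tblSide 0 e = 1) ∪
      (R.filter fun e => s.nat tblSide 0 e = 2) = R := by
    ext e
    simp only [Finset.mem_union, Finset.mem_filter]
    constructor
    · rintro (h | h) <;> exact h.1
    · intro he
      have h1 := h0 e he
      have h2 := hB.side_le e he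
      have : s.nat tblSide 0 e = 1 ∨ s.nat tblSide 0 e = 2 := by omega
      tauto
  have hab := abs_le.1 hB.abs_v
  refine .ite (fun ht => .seq (.setNat (.setNat ?_)))
    (fun ht => .seq (.setNat (.seq (.setNat (.seq (.setReal (.setReal ?_))))))) <;>
    simp only [holds_realLe, RealExpr.eval, NatExpr.eval] at ht
  · refine ⟨_, _, hdisj, hunion, by simp, by simp, by simpa using hu, by simpa using hv,
      by simpa using hB.abs_u, by simpa using ht, by simpa using hab.2⟩
  · refine ⟨_, _, hdisj.symm, by rw [Finset.union_comm]; exact hunion, by simp, by simp, ?_, ?_, ?_,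
      ?_, ?_⟩
    · simp only [writeReal_real, RealExpr.eval, NatExpr.eval]
      simp [hu]
    · simp only [writeReal_real, RealExpr.eval, NatExpr.eval]
      simp [hv]
    · simpa using hB.abs_u
    · simpa using le_of_not_ge ht
    · simp
      linarith [hab.1]

/-- Compute the split of the edges between the agent in `varI` and the agent she points to. -/
def childStep : RamProg :=
  .seq (setVar varA (entry tblPt (var varI))) <|
  .seq (setVar varB (var varI)) <|
  .seq (setVar varSkip (entry tblFav (var varI))) <|
  .seq balanceProg <|
  .seq orderProg <|
  .seq (.ite (.and (.not (.realLe (.add (rvar varDiffA) (.value (var varA) (var varSkip))) .one))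
      (.not (.realLe (.add (rvar varDiffB) (.value (var varA) (var varSkip)))
        (.add (rvar varDiffA) .one))))
    (setEntry tblMove (var varI) (.const 1)) (setEntry tblMove (var varI) (.const 0))) <|
  .seq (dealProg tblTake varPart varB varA) <|
  .ite (.realLe (.add (rvar varDiffA) (.value (var varA) (var varSkip))) .one)
    (dealProg tblKeep varOther varA varB) (dealProg tblKeep varPart varA varB)

theorem runs_childStep {X : RamInput} (hX : Valid X) (s : RamState) {l : ℕ}
    (hl : s.nat varI 0 0 = l) :
    Runs X childStep s fun s' =>
      (∃ P Q, ChildSplit X (s.nat tblPt 0 l) l (s.nat tblFav 0 l) P Q (s'.nat tblMove 0 l = 1)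
        (s'.nat tblTake l) (s'.nat tblKeep l)) ∧
      ∀ i, i ≠ l → s'.nat tblMove 0 i = s.nat tblMove 0 i ∧ s'.nat tblTake i = s.nat tblTake i ∧
        s'.nat tblKeep i = s.nat tblKeep i := by
  refine .seq (.setNat (.seq (.setNat (.seq (.setNat ?_)))))
  simp only [NatExpr.eval]
  set a := s.nat tblPt 0 l with ha
  set f := s.nat tblFav 0 l with hf
  set s1 := RamState.writeNat _ _ _ _ _ with hs1
  have n1 : ∀ b, b ≠ varA → b ≠ varB → b ≠ varSkip → s1.nat b = s.nat b := by
    intro b h1 h2 h3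
    rw [hs1, writeNat_nat_of_ne _ _ _ _ h3, writeNat_nat_of_ne _ _ _ _ h2,
      writeNat_nat_of_ne _ _ _ _ h1]
  have eA1 : s1.nat varA 0 0 = a := by simp [hs1, hl, ha]
  have eB1 : s1.nat varB 0 0 = l := by simp [hs1, hl]
  have eS1 : s1.nat varSkip 0 0 = f := by simp [hs1, hl, hf]
  refine .seq ((runs_balanceProg hX s1).imp_agree fun s2 ⟨hB, h0⟩ a2 => ?_)
  have hit : items X s1 = (between X a l).erase f := by rw [items, eA1, eB1, eS1]
  rw [hit] at hB h0
  rw [eA1, eB1] at hB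
  refine .seq ((runs_orderProg s2 hB h0).imp_agree
    fun s3 ⟨P, Q, hPQ, hU, hP, hQ, hdA, hdB, hA1, hB0, hB1⟩ a3 => ?_)
  have n3 : ∀ b, writesNat b balanceProg = false → writesNat b orderProg = false →
      s3.nat b = s1.nat b := fun b h1 h2 => (a3.nat b h2).trans (a2.nat b h1)
  have eA3 : s3.nat varA 0 0 = a := by rw [n3 varA rfl rfl, eA1]
  have eB3 : s3.nat varB 0 0 = l := by rw [n3 varB rfl rfl, eB1]
  have eS3 : s3.nat varSkip 0 0 = f := by rw [n3 varSkip rfl rfl, eS1]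
  have eI3 : s3.nat varI 0 0 = l := by
    rw [n3 varI rfl rfl, n1 varI (by decide) (by decide) (by decide), hl]
  have eT3 : s3.nat tblSide = s2.nat tblSide := a3.nat tblSide rfl
  have eM3 : s3.nat tblMove = s.nat tblMove := by
    rw [n3 tblMove rfl rfl, n1 tblMove (by decide) (by decide) (by decide)]
  have eTk3 : s3.nat tblTake = s.nat tblTake := by
    rw [n3 tblTake rfl rfl, n1 tblTake (by decide) (by decide) (by decide)]
  have eK3 : s3.nat tblKeep = s.nat tblKeep := by
    rw [n3 tblKeep rfl rfl, n1 tblKeep (by decide) (by decide) (by decide)]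
  have memP : ∀ e ∈ between X a l, (e ≠ f ∧ s2.nat tblSide 0 e = s3.nat varPart 0 0) ↔ e ∈ P := by
    intro e he
    rw [hP, Finset.mem_filter, Finset.mem_erase]
    tauto
  have memQ : ∀ e ∈ between X a l, (e ≠ f ∧ s2.nat tblSide 0 e = s3.nat varOther 0 0) ↔ e ∈ Q := by
    intro e he
    rw [hQ, Finset.mem_filter, Finset.mem_erase]
    tauto
  clear_value s1
  set move : Prop := 1 - X.value a f < ∑ e ∈ P, X.value a e - ∑ e ∈ Q, X.value a e ∧
    ∑ e ∈ P, X.value a e - ∑ e ∈ Q, X.value a e + 1 - X.value a f <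
      ∑ e ∈ P, X.value l e - ∑ e ∈ Q, X.value l e with hmove
  -- after the test for a move
  have rest : ∀ s4 : RamState, (∀ b, b ≠ tblMove → s4.nat b = s3.nat b) → s4.real = s3.real →
      (s4.nat tblMove 0 l = 1 ↔ move) → (∀ i, i ≠ l → s4.nat tblMove 0 i = s.nat tblMove 0 i) →
      Runs X (.seq (dealProg tblTake varPart varB varA) <|
        .ite (.realLe (.add (rvar varDiffA) (.value (var varA) (var varSkip))) .one)
        (dealProg tblKeep varOther varA varB) (dealProg tblKeep varPart varA varB)) s4 fun s' =>
      (∃ P Q, ChildSplit X a l f P Q (s'.nat tblMove 0 l = 1)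
        (s'.nat tblTake l) (s'.nat tblKeep l)) ∧
      ∀ i, i ≠ l → s'.nat tblMove 0 i = s.nat tblMove 0 i ∧ s'.nat tblTake i = s.nat tblTake i ∧
        s'.nat tblKeep i = s.nat tblKeep i := by
    intro s4 n4 r4 hm hm'
    refine .seq ((runs_dealProg s4 (Or.inl rfl) (Or.inl rfl) (Or.inr rfl) (Or.inl rfl)).imp_agree
      fun s5 ⟨hrow, htake⟩ a5 => ?_)
    rw [n4 varI (by decide), eI3] at hrow htake
    rw [n4 varSkip (by decide), eS3, n4 tblSide (by decide), eT3, n4 varPart (by decide),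
      n4 varA (by decide), eA3, n4 varB (by decide), eB3] at htake
    have n5 : ∀ b, writesNat b (dealProg tblTake varPart varB varA) = false → b ≠ tblMove →
        s5.nat b = s3.nat b := fun b h1 h2 => (a5.nat b h1).trans (n4 b h2)
    have r5 : s5.real = s3.real := by
      funext b; rw [a5.real b rfl, r4]
    have fin : ∀ s6 : RamState, Agree (dealProg tblKeep varOther varA varB) s5 s6 →
        (∀ i, i ≠ l → s6.nat tblKeep i = s5.nat tblKeep i) →
        ((X.value a f + ∑ e ∈ P, X.value a e ≤ 1 + ∑ e ∈ Q, X.value a e ∧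
          ∀ e ∈ between X a l, s6.nat tblKeep l e = if e ∈ Q then a else l) ∨
        (1 + ∑ e ∈ Q, X.value a e < X.value a f + ∑ e ∈ P, X.value a e ∧
          ∀ e ∈ between X a l, s6.nat tblKeep l e = if e ∈ P then a else l)) →
        (∃ P Q, ChildSplit X a l f P Q (s6.nat tblMove 0 l = 1)
          (s6.nat tblTake l) (s6.nat tblKeep l)) ∧
        ∀ i, i ≠ l → s6.nat tblMove 0 i = s.nat tblMove 0 i ∧
          s6.nat tblTake i = s.nat tblTake i ∧ s6.nat tblKeep i = s.nat tblKeep i := by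
      intro s6 a6 hrow' hkeep
      have eM6 : s6.nat tblMove = s4.nat tblMove :=
        (a6.nat tblMove rfl).trans (a5.nat tblMove rfl)
      have eT6 : s6.nat tblTake = s5.nat tblTake := a6.nat tblTake rfl
      refine ⟨⟨P, Q, hPQ, hU, ?_, ?_, ?_, ?_, ?_, hkeep⟩, fun i hi => ⟨?_, ?_, ?_⟩⟩
      · linarith [(abs_le.1 hA1).2]
      · linarith
      · linarith
      · rw [eM6, hm]
      · intro e he
        rw [eT6, htake e (mem_between.1 he).1]
        simp only [memP e he]
      · rw [eM6, hm' i hi]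
      · rw [eT6, hrow i hi, n4 tblTake (by decide), eTk3]
      · rw [hrow' i hi, n5 tblKeep rfl (by decide), eK3]
    refine .ite (fun ht => ?_) (fun ht => ?_)
    · refine (runs_dealProg s5 (Or.inr rfl) (Or.inr rfl) (Or.inl rfl) (Or.inr rfl)).imp_agree
        fun s6 ⟨hrow', hkeep⟩ a6 => ?_
      rw [n5 varI rfl (by decide), eI3] at hrow' hkeep
      rw [n5 varSkip rfl (by decide), eS3, n5 tblSide rfl (by decide), eT3,
        n5 varOther rfl (by decide), n5 varA rfl (by decide), eA3, n5 varB rfl (by decide),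
        eB3] at hkeep
      refine fin s6 a6 hrow' (Or.inl ⟨?_, fun e he => ?_⟩)
      · simp only [holds_realLe, RealExpr.eval, NatExpr.eval, r5, hdA, n5 varA rfl (by decide), eA3,
          n5 varSkip rfl (by decide), eS3] at ht
        linarith
      · rw [hkeep e (mem_between.1 he).1]
        simp only [memQ e he]
    · refine (runs_dealProg s5 (Or.inr rfl) (Or.inl rfl) (Or.inl rfl) (Or.inr rfl)).imp_agree
        fun s6 ⟨hrow', hkeep⟩ a6 => ?_
      rw [n5 varI rfl (by decide), eI3] at hrow' hkeep
      rw [n5 varSkip rfl (by decide), eS3, n5 tblSide rfl (by decide), eT3,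
        n5 varPart rfl (by decide), n5 varA rfl (by decide), eA3, n5 varB rfl (by decide),
        eB3] at hkeep
      refine fin s6 ⟨fun b hb => a6.nat b hb, fun b hb => a6.real b hb⟩ hrow'
        (Or.inr ⟨?_, fun e he => ?_⟩)
      · simp only [holds_realLe, RealExpr.eval, NatExpr.eval, r5, hdA, n5 varA rfl (by decide), eA3,
          n5 varSkip rfl (by decide), eS3] at ht
        linarith
      · rw [hkeep e (mem_between.1 he).1]
        simp only [memP e he]
  refine .seq (.ite (fun ht => .setNat ?_) (fun ht => .setNat ?_)) <;>
    simp only [holds_and, holds_not, holds_realLe, RealExpr.eval, NatExpr.eval, hdA, hdB, eA3, eS3,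
      eI3, not_le] at ht ⊢
  · refine rest _ (fun b hb => writeNat_nat_of_ne _ _ _ _ hb) rfl ?_ (fun i hi => ?_)
    · simp only [writeNat_nat, and_self, if_true, true_iff]
      exact ⟨by linarith, by linarith⟩
    · simp [hi, eM3]
  · refine rest _ (fun b hb => writeNat_nat_of_ne _ _ _ _ hb) rfl ?_ (fun i hi => ?_)
    · simp only [writeNat_nat, and_self, if_true, zero_ne_one, false_iff]
      exact fun hmv => ht ⟨by linarith [hmv.1], by linarith [hmv.2]⟩
    · simp [hi, eM3]

/-- Compute the splits for all pairs that are linked by a pointer. -/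
def childProg : RamProg := forLoop varI .numAgents childStep

theorem runs_childProg {X : RamInput} (hX : Valid X) (s : RamState) :
    Runs X childProg s fun s' => ∀ l < X.numAgents, ∃ P Q,
      ChildSplit X (s.nat tblPt 0 l) l (s.nat tblFav 0 l) P Q (s'.nat tblMove 0 l = 1)
        (s'.nat tblTake l) (s'.nat tblKeep l) := by
  refine .forLoop X.numAgents (fun k s' => ∀ l < k, ∃ P Q,
      ChildSplit X (s.nat tblPt 0 l) l (s.nat tblFav 0 l) P Q (s'.nat tblMove 0 l = 1)
        (s'.nat tblTake l) (s'.nat tblKeep l)) (by omega) (fun _ => rfl) rfl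
    (fun k s' x h => by simpa [writeNat_nat_of_ne] using h) (by simp) ?_ (fun _ _ h => h)
  intro k hk s' ha hkc hI
  refine (runs_childStep hX s' hkc).imp fun s'' ⟨h1, h2⟩ l hl => ?_
  rcases Nat.lt_succ_iff_lt_or_eq.1 hl with hl | rfl
  · obtain ⟨e1, e2, e3⟩ := h2 l (by omega)
    rw [e1, e2, e3]
    exact hI l hl
  · rwa [ha.nat tblPt rfl, ha.nat tblFav rfl] at h1

/-! ### The chains of agents who take over favourite edges -/

/-- Agent `l` is the smaller one of a pair of agents who point to each other. -/
def IsStart (T : ℕ → ℕ) (l : ℕ) : Prop := T (T l) = l ∧ l < T l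

/-- The test for `IsStart`. -/
def startTest (l : NatExpr) : RamTest :=
  .and (eqTest (entry tblPt (entry tblPt l)) l) (.not (.natLe (entry tblPt l) l))

@[simp] theorem holds_startTest {X : RamInput} {s : RamState} {l : NatExpr} :
    (startTest l).Holds X s ↔ IsStart (s.nat tblPt 0) (l.eval X s) := by
  simp [startTest, IsStart]

/-- For every agent, find the most valuable favourite edge that she would take from a child; the
entry is `0` if there is none, and else the number of the child plus `1`. -/
def bestProg : RamProg :=
  forLoop varI .numAgents <|
    .ite (.and (.not (startTest (var varI))) (.and (eqTest (entry tblMove (var varI)) (.const 1))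
        (orTest (.natLe (entry tblBest (entry tblPt (var varI))) (.const 0))
          (.realLe (.value (entry tblPt (var varI))
              (entry tblFav (.sub (entry tblBest (entry tblPt (var varI))) (.const 1))))
            (.value (entry tblPt (var varI)) (entry tblFav (var varI)))))))
      (setEntry tblBest (entry tblPt (var varI)) (.add (var varI) (.const 1))) .skip

/-- The entry `b` for agent `a` in the table of best children, for children below `k`. -/
def IsBest (X : RamInput) (T F M : ℕ → ℕ) (k a b : ℕ) : Prop :=
  (b = 0 ∧ ∀ l < k, T l = a → ¬ IsStart T l → M l ≠ 1) ∨
  ∃ j < k, b = j + 1 ∧ T j = a ∧ ¬ IsStart T j ∧ M j = 1 ∧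
    ∀ l < k, T l = a → ¬ IsStart T l → M l = 1 → X.value a (F l) ≤ X.value a (F j)

theorem runs_bestProg {X : RamInput} (s : RamState) (h0 : ∀ a, s.nat tblBest 0 a = 0) :
    Runs X bestProg s fun s' => ∀ a, IsBest X (s.nat tblPt 0) (s.nat tblFav 0) (s.nat tblMove 0)
      X.numAgents a (s'.nat tblBest 0 a) := by
  refine .forLoop X.numAgents (fun k s' => ∀ a, IsBest X (s.nat tblPt 0) (s.nat tblFav 0)
      (s.nat tblMove 0) k a (s'.nat tblBest 0 a)) (by omega) (fun _ => rfl) rfl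
    (fun k s' x h => by simpa [writeNat_nat_of_ne] using h) (fun a => Or.inl (by simp [h0])) ?_
    (fun _ _ h => h)
  intro i hi s' ha hki hI
  have kP := ha.nat tblPt rfl
  have kF := ha.nat tblFav rfl
  have kM := ha.nat tblMove rfl
  set T := s.nat tblPt 0
  set F := s.nat tblFav 0
  set M := s.nat tblMove 0
  refine .ite (fun ht => .setNat ?_) (fun ht => .skip ?_) <;>
    simp only [holds_and, holds_not, holds_startTest, holds_eq, holds_or, holds_natLe, holds_realLe,
      RealExpr.eval, NatExpr.eval, hki, kP, kF, kM, nonpos_iff_eq_zero] at ht ⊢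
  · intro a
    by_cases hai : a = T i
    · subst hai
      rw [writeNat_nat, if_pos ⟨rfl, rfl, rfl⟩]
      refine Or.inr ⟨i, by omega, rfl, rfl, ht.1, ht.2.1, fun l hl h1 h2 h3 => ?_⟩
      rcases Nat.lt_succ_iff_lt_or_eq.1 hl with hl | rfl
      · rcases hI (T i) with ⟨e, hn⟩ | ⟨j, hj, e, h4, h5, h6, h7⟩
        · exact absurd h3 (hn l hl h1 h2)
        · rw [e] at ht
          refine (h7 l hl h1 h2 h3).trans ?_
          simpa using ht.2.2
      · exact le_rfl
    · rw [writeNat_nat, if_neg (by tauto)]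
      rcases hI a with ⟨e, hn⟩ | ⟨j, hj, e, h4, h5, h6, h7⟩
      · refine Or.inl ⟨e, fun l hl h1 => ?_⟩
        rcases Nat.lt_succ_iff_lt_or_eq.1 hl with hl | rfl
        · exact hn l hl h1
        · exact absurd h1.symm hai
      · refine Or.inr ⟨j, by omega, e, h4, h5, h6, fun l hl h1 => ?_⟩
        rcases Nat.lt_succ_iff_lt_or_eq.1 hl with hl | rfl
        · exact h7 l hl h1
        · exact absurd h1.symm hai
  · intro a
    rcases hI a with ⟨e, hn⟩ | ⟨j, hj, e, h4, h5, h6, h7⟩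
    · refine Or.inl ⟨e, fun l hl h1 h2 h3 => ?_⟩
      rcases Nat.lt_succ_iff_lt_or_eq.1 hl with hl | rfl
      · exact hn l hl h1 h2 h3
      · have h1' : s.nat tblPt 0 l = a := h1
        exact ht ⟨h2, h3, Or.inl (by rw [h1']; exact e)⟩
    · refine Or.inr ⟨j, by omega, e, h4, h5, h6, fun l hl h1 h2 h3 => ?_⟩
      rcases Nat.lt_succ_iff_lt_or_eq.1 hl with hl | rfl
      · exact h7 l hl h1 h2 h3
      · by_contra hlt
        have h1' : s.nat tblPt 0 l = a := h1
        refine ht ⟨h2, h3, Or.inr ?_⟩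
        rw [h1', e]
        simpa using le_of_not_ge hlt

/-- The agents reached after `k` rounds, along the chains that begin at the starting agents and lead
from each agent to her best child. -/
def Reached (T best : ℕ → ℕ) : ℕ → ℕ → Prop
  | 0, _ => False
  | k + 1, l => IsStart T l ∨ (Reached T best k (T l) ∧ best (T l) = l + 1)

theorem Reached.succ {T best : ℕ → ℕ} {k l : ℕ} (h : Reached T best k l) :
    Reached T best (k + 1) l := by
  induction k generalizing l with
  | zero => exact h.elim
  | succ k ih =>
    rcases h with h | ⟨h1, h2⟩
    · exact Or.inl h
    · exact Or.inr ⟨ih h1, h2⟩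

theorem Reached.mono {T best : ℕ → ℕ} {k k' l : ℕ} (h : Reached T best k l) (hk : k ≤ k') :
    Reached T best k' l := by
  induction hk with
  | refl => exact h
  | step _ ih => exact ih.succ

/-- No new agents are reached after `n` rounds: otherwise the `n + 1` agents on the way back would
be distinct, since each of them is reached one round before the next. -/
theorem reached_stable {T best : ℕ → ℕ} {n : ℕ} (hT : ∀ l < n, T l < n) {l : ℕ} (hl : l < n) :
    Reached T best n l ↔ IsStart T l ∨ (Reached T best n (T l) ∧ best (T l) = l + 1) := by
  refine ⟨fun h => h.succ, fun h => ?_⟩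
  replace h : Reached T best (n + 1) l := h
  by_contra hn
  have hlt : ∀ j, T^[j] l < n := by
    intro j
    induction j with
    | zero => exact hl
    | succ j ih => rw [Function.iterate_succ_apply']; exact hT _ ih
  have chain : ∀ j ≤ n, Reached T best (n + 1 - j) (T^[j] l) ∧
      ¬ Reached T best (n - j) (T^[j] l) := by
    intro j
    induction j with
    | zero => intro _; exact ⟨h, hn⟩
    | succ j ih =>
      intro hj
      obtain ⟨h1, h2⟩ := ih (by omega)
      obtain ⟨r, hr⟩ : ∃ r, n - j = r + 1 := ⟨n - j - 1, by omega⟩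
      rw [show n + 1 - j = n - j + 1 by omega] at h1
      rw [hr] at h2
      rw [Function.iterate_succ_apply', show n + 1 - (j + 1) = n - j by omega,
        show n - (j + 1) = r by omega]
      rcases h1 with h1 | ⟨h3, h4⟩
      · exact absurd (Or.inl h1) h2
      · exact ⟨h3, fun h5 => h2 (Or.inr ⟨h5, h4⟩)⟩
  obtain ⟨i, j, hij, heq⟩ := Fintype.exists_ne_map_eq_of_card_lt
    (fun i : Fin (n + 1) => (⟨T^[i] l, hlt i⟩ : Fin n)) (by simp)
  have main : ∀ i j : ℕ, i < j → j ≤ n → T^[i] l = T^[j] l → False := by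
    intro i j hij hj e
    have h1 := (chain j hj).1
    rw [← e] at h1
    exact (chain i (by omega)).2 (h1.mono (by omega))
  have hi := i.2
  have hj := j.2
  have heq := Fin.mk.inj heq
  rcases lt_or_gt_of_ne (fun h => hij (Fin.ext h)) with h | h
  · exact main i j h (by omega) heq
  · exact main j i h (by omega) heq.symm

/-- Row `k` of the table records the agents reached after `k` rounds. -/
def actProg : RamProg :=
  forLoop varJ .numAgents <| forLoop varI .numAgents <|
    .ite (orTest (startTest (var varI))
        (.and (eqTest (.cell tblAct (var varJ) (entry tblPt (var varI))) (.const 1))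
          (eqTest (entry tblBest (entry tblPt (var varI))) (.add (var varI) (.const 1)))))
      (.setNat tblAct (.add (var varJ) (.const 1)) (var varI) (.const 1)) .skip

theorem runs_actProg {X : RamInput} (s : RamState) (h0 : ∀ k l, s.nat tblAct k l = 0)
    (hT : ∀ l < X.numAgents, s.nat tblPt 0 l < X.numAgents) :
    Runs X actProg s fun s' => ∀ l < X.numAgents, (s'.nat tblAct X.numAgents l = 1 ↔
      Reached (s.nat tblPt 0) (s.nat tblBest 0) X.numAgents l) := by
  set T := s.nat tblPt 0 with hTdef
  set best := s.nat tblBest 0 with hbest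
  refine .forLoop X.numAgents (fun k s' => (∀ l < X.numAgents, (s'.nat tblAct k l = 1 ↔
      Reached T best k l)) ∧ ∀ j > k, ∀ l, s'.nat tblAct j l = 0) (by omega) (fun _ => rfl) rfl
    (fun k s' x h => by simpa [writeNat_nat_of_ne] using h) (by simp [h0, Reached]) ?_
    (fun _ _ h => h.1)
  intro k hk s1 a1 hk1 ⟨hI1, hI2⟩
  refine .forLoop X.numAgents (fun i s' => (∀ l < X.numAgents, (s'.nat tblAct k l = 1 ↔
      Reached T best k l)) ∧ (∀ l < i, (s'.nat tblAct (k + 1) l = 1 ↔ Reached T best (k + 1) l)) ∧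
      (∀ l ≥ i, s'.nat tblAct (k + 1) l = 0) ∧
      ∀ j > k + 1, ∀ l, s'.nat tblAct j l = 0) (by omega) (fun _ => rfl) rfl
    (fun k s' x h => by simpa [writeNat_nat_of_ne] using h)
    ⟨hI1, by simp, fun l _ => hI2 _ (by omega) l, fun j hj l => hI2 j (by omega) l⟩ ?_
    (fun _ _ h => ⟨h.2.1, h.2.2.2⟩)
  intro i hi s2 a2 hi2 ⟨h1, h2, h3, h4⟩
  have kP : s2.nat tblPt = s.nat tblPt := (a2.nat tblPt rfl).trans (a1.nat tblPt rfl)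
  have kB : s2.nat tblBest = s.nat tblBest := (a2.nat tblBest rfl).trans (a1.nat tblBest rfl)
  have kJ : s2.nat varJ 0 0 = k := by rw [a2.nat varJ rfl, hk1]
  refine .ite (fun ht => .setNat ?_) (fun ht => .skip ?_) <;>
    simp only [holds_and, holds_startTest, holds_eq, holds_or, NatExpr.eval, hi2, kP, kB, kJ,
      ← hTdef, ← hbest] at ht ⊢ <;> rw [h1 _ (hT i hi)] at ht
  · refine ⟨fun l hl => ?_, fun l hl => ?_, fun l hl => ?_, fun j hj l => ?_⟩
    · rw [writeNat_nat, if_neg (by omega), h1 l hl]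
    · rcases Nat.lt_succ_iff_lt_or_eq.1 hl with hl | rfl
      · rw [writeNat_nat, if_neg (by omega), h2 l hl]
      · simpa [Reached] using ht
    · rw [writeNat_nat, if_neg (by omega), h3 l (by omega)]
    · rw [writeNat_nat, if_neg (by omega), h4 j hj]
  · refine ⟨h1, fun l hl => ?_, fun l hl => h3 l (by omega), h4⟩
    rcases Nat.lt_succ_iff_lt_or_eq.1 hl with hl | rfl
    · exact h2 l hl
    · rw [h3 l le_rfl]
      simpa [Reached] using ht

/-! ### The remaining pairs of agents -/

/-- The value for `i` of the items between `a` and `b` that `k` owns. -/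
noncomputable def share (X : RamInput) (own : ℕ → ℕ) (i a b k : ℕ) : ℝ :=
  ∑ e ∈ (between X a b).filter (fun e => own e = k), X.value i e

theorem share_congr {X : RamInput} {own own' : ℕ → ℕ} {a b : ℕ}
    (h : ∀ e ∈ between X a b, own e = own' e) (i k : ℕ) :
    share X own i a b k = share X own' i a b k := by
  unfold share
  rw [Finset.filter_congr fun e he => by rw [h e he]]

theorem share_comm (X : RamInput) (own : ℕ → ℕ) (i a b k : ℕ) :
    share X own i a b k = share X own i b a k := by
  rw [share, share, between_comm]

/-- The items between `a` and `b` are split into two parts that differ by at most `1` for both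
agents, and assigned so that the welfare would not increase by an exchange. -/
structure CrossSplit (X : RamInput) (own : ℕ → ℕ) (a b : ℕ) : Prop where
  own_eq : ∀ e ∈ between X a b, own e = a ∨ own e = b
  le_left : share X own a a b b ≤ share X own a a b a + 1
  le_right : share X own b a b a ≤ share X own b a b b + 1
  welfare : share X own a a b b + share X own b a b a ≤ share X own a a b a + share X own b a b b

theorem CrossSplit.congr {X : RamInput} {own own' : ℕ → ℕ} {a b : ℕ} (h : CrossSplit X own a b)
    (he : ∀ e ∈ between X a b, own e = own' e) : CrossSplit X own' a b where
  own_eq e h' := by rw [← he e h']; exact h.own_eq e h'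
  le_left := by simpa only [share_congr he] using h.le_left
  le_right := by simpa only [share_congr he] using h.le_right
  welfare := by simpa only [share_congr he] using h.welfare

/-- Split the items between the agents in `varI` and `varJ` without regard to favourites. -/
def crossStep : RamProg :=
  .seq (setVar varA (var varI)) <| .seq (setVar varB (var varJ)) <|
  -- no item is left out
  .seq (setVar varSkip .numItems) <| .seq balanceProg <|
  .seq (.ite (.realLe (rvar varDiffB) (rvar varDiffA)) (setVar varPart (.const 1))
    (setVar varPart (.const 2))) <|
  forLoop varE .numItems <| .ite (inPair (var varE))
    (.ite (eqTest (entry tblSide (var varE)) (var varPart))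
      (setEntry tblCross (var varE) (var varA)) (setEntry tblCross (var varE) (var varB)))
    .skip

theorem runs_crossStep {X : RamInput} (hX : Valid X) (s : RamState) {a b : ℕ}
    (ha : s.nat varI 0 0 = a) (hb : s.nat varJ 0 0 = b) (hab : a ≠ b) :
    Runs X crossStep s fun s' => CrossSplit X (s'.nat tblCross 0) a b ∧
      ∀ e, ¬ Joins X a b e → s'.nat tblCross 0 e = s.nat tblCross 0 e := by
  refine .seq (.setNat (.seq (.setNat (.seq (.setNat ?_)))))
  simp only [NatExpr.eval]
  set s1 := RamState.writeNat _ _ _ _ _ with hs1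
  have n1 : ∀ c, c ≠ varA → c ≠ varB → c ≠ varSkip → s1.nat c = s.nat c := by
    intro b h1 h2 h3
    rw [hs1, writeNat_nat_of_ne _ _ _ _ h3, writeNat_nat_of_ne _ _ _ _ h2,
      writeNat_nat_of_ne _ _ _ _ h1]
  have eA1 : s1.nat varA 0 0 = a := by simp [hs1, ha]
  have eB1 : s1.nat varB 0 0 = b := by simp [hs1, hb]
  have eS1 : s1.nat varSkip 0 0 = X.numItems := by simp [hs1]
  clear_value s1
  refine .seq ((runs_balanceProg hX s1).imp_agree fun s2 ⟨hB, h0⟩ a2 => ?_)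
  have hit : items X s1 = between X a b := by
    rw [items, eA1, eB1, eS1, Finset.erase_eq_of_notMem]
    simp [mem_between]
  rw [hit] at hB h0
  rw [eA1, eB1] at hB
  set σ := s2.nat tblSide 0 with hσ
  have hdu := hB.eq_u
  have hdv := hB.eq_v
  rw [sum_sgn_eq _ hB.side_le] at hdu hdv
  have h12 : ∀ e ∈ between X a b, σ e = 1 ∨ σ e = 2 := fun e he => by
    have h1 := hB.side_le e he
    have h2 := h0 e he
    omega
  have hu1 := abs_le.1 hB.abs_u
  have hv1 := abs_le.1 hB.abs_v
  have rest : ∀ s3 : RamState, (∀ c, c ≠ varPart → s3.nat c = s2.nat c) →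
      ((s3.nat varPart 0 0 = 1 ∧ s2.real varDiffB 0 0 ≤ s2.real varDiffA 0 0) ∨
        (s3.nat varPart 0 0 = 2 ∧ s2.real varDiffA 0 0 ≤ s2.real varDiffB 0 0)) →
      Runs X (forLoop varE .numItems <| .ite (inPair (var varE))
        (.ite (eqTest (entry tblSide (var varE)) (var varPart))
          (setEntry tblCross (var varE) (var varA)) (setEntry tblCross (var varE) (var varB)))
        .skip) s3 fun s' => CrossSplit X (s'.nat tblCross 0) a b ∧
          ∀ e, ¬ Joins X a b e → s'.nat tblCross 0 e = s.nat tblCross 0 e := by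
    intro s3 n3 hpart
    have eA3 : s3.nat varA 0 0 = a := by rw [n3 varA (by decide), a2.nat varA rfl, eA1]
    have eB3 : s3.nat varB 0 0 = b := by rw [n3 varB (by decide), a2.nat varB rfl, eB1]
    have eS3 : s3.nat varSkip 0 0 = X.numItems := by
      rw [n3 varSkip (by decide), a2.nat varSkip rfl, eS1]
    have eT3 : s3.nat tblSide 0 = σ := by rw [n3 tblSide (by decide)]
    have eC3 : s3.nat tblCross = s.nat tblCross := by
      rw [n3 tblCross (by decide), a2.nat tblCross rfl,
        n1 tblCross (by decide) (by decide) (by decide)]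
    set κ := s3.nat varPart 0 0 with hκ
    refine .forLoop X.numItems (fun k s' => (∀ e < k, Joins X a b e → s'.nat tblCross 0 e =
        if σ e = κ then a else b) ∧ ∀ e, ¬ Joins X a b e → s'.nat tblCross 0 e = s.nat tblCross 0 e)
      (by omega) (fun _ => rfl) rfl (fun k s' x h => by simpa [writeNat_nat_of_ne] using h)
      (by simp [eC3]) ?_ ?_
    · intro k hk s4 a4 hk4 ⟨hI1, hI2⟩
      have eA4 : s4.nat varA 0 0 = a := by rw [a4.nat varA rfl, eA3]
      have eB4 : s4.nat varB 0 0 = b := by rw [a4.nat varB rfl, eB3]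
      have eS4 : s4.nat varSkip 0 0 = X.numItems := by rw [a4.nat varSkip rfl, eS3]
      have eT4 : s4.nat tblSide 0 = σ := by rw [a4.nat tblSide rfl, eT3]
      have eP4 : s4.nat varPart 0 0 = κ := by rw [a4.nat varPart rfl]
      have done : ∀ z, Joins X a b k → z = (if σ k = κ then a else b) →
          (∀ e < k + 1, Joins X a b e → (s4.writeNat tblCross 0 k z).nat tblCross 0 e =
            if σ e = κ then a else b) ∧
          ∀ e, ¬ Joins X a b e → (s4.writeNat tblCross 0 k z).nat tblCross 0 e =
            s.nat tblCross 0 e := by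
        intro z hj hz
        rw [writeNat_row]
        refine ⟨fun e he hje => ?_, fun e he => ?_⟩
        · rcases Nat.lt_succ_iff_lt_or_eq.1 he with he | rfl
          · rw [Function.update_of_ne (by omega), hI1 e he hje]
          · rw [Function.update_self, hz]
        · rw [Function.update_of_ne (by rintro rfl; exact he hj), hI2 e he]
      refine .ite (fun ht => .ite (fun ht' => .setNat ?_) (fun ht' => .setNat ?_))
          (fun ht => .skip ⟨fun e he hje => ?_, hI2⟩) <;>
        simp only [holds_inPair, NatExpr.eval, hk4, eA4, eB4, eS4] at ht
      · simp only [holds_eq, NatExpr.eval, hk4, eT4, eP4] at ht'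
        simp only [NatExpr.eval, hk4, eA4]
        exact done _ ht.2 (by rw [if_pos ht'])
      · simp only [holds_eq, NatExpr.eval, hk4, eT4, eP4] at ht'
        simp only [NatExpr.eval, hk4, eB4]
        exact done _ ht.2 (by rw [if_neg ht'])
      · rcases Nat.lt_succ_iff_lt_or_eq.1 he with he | rfl
        · exact hI1 e he hje
        · exact absurd ⟨by omega, hje⟩ ht
    · intro s4 a4 ⟨hI1, hI2⟩
      refine ⟨?_, hI2⟩
      have hown : ∀ e ∈ between X a b, s4.nat tblCross 0 e = if σ e = κ then a else b := fun e he =>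
        hI1 e (mem_between.1 he).1 (mem_between.1 he).2
      have hsa : ∀ i, share X (s4.nat tblCross 0) i a b a =
          ∑ e ∈ (between X a b).filter (fun e => σ e = κ), X.value i e := fun i => by
        unfold share
        congr 1
        refine Finset.filter_congr fun e he => ?_
        rw [hown e he]
        split_ifs <;> simp_all [hab.symm]
      have hsb : ∀ i, share X (s4.nat tblCross 0) i a b b =
          ∑ e ∈ (between X a b).filter (fun e => σ e ≠ κ), X.value i e := fun i => by
        unfold share
        congr 1
        refine Finset.filter_congr fun e he => ?_
        rw [hown e he]
        split_ifs <;> simp_all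
      have hother : ∀ κ', (κ = 1 ∧ κ' = 2) ∨ (κ = 2 ∧ κ' = 1) →
          (between X a b).filter (fun e => σ e ≠ κ) =
            (between X a b).filter (fun e => σ e = κ') := by
        intro κ' hk
        refine Finset.filter_congr fun e he => ?_
        have := h12 e he
        omega
      have hmem : ∀ e ∈ between X a b, s4.nat tblCross 0 e = a ∨ s4.nat tblCross 0 e = b := by
        intro e he
        rw [hown e he]
        split_ifs <;> simp
      rcases hpart with ⟨hk, hle⟩ | ⟨hk, hle⟩
      · have := hother 2 (Or.inl ⟨hk, rfl⟩)
        refine ⟨hmem, ?_, ?_, ?_⟩ <;> simp only [hsa, hsb, this] <;> rw [hk] <;> linarith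
      · have := hother 1 (Or.inr ⟨hk, rfl⟩)
        refine ⟨hmem, ?_, ?_, ?_⟩ <;> simp only [hsa, hsb, this] <;> rw [hk] <;> linarith
  refine .seq (.ite (fun ht => .setNat ?_) (fun ht => .setNat ?_)) <;>
    simp only [holds_realLe, RealExpr.eval, NatExpr.eval] at ht ⊢
  · exact rest _ (fun c hc => writeNat_nat_of_ne _ _ _ _ hc) (Or.inl ⟨by simp, ht⟩)
  · exact rest _ (fun c hc => writeNat_nat_of_ne _ _ _ _ hc) (Or.inr ⟨by simp, le_of_not_ge ht⟩)

/-- Split the items of every pair of agents without regard to favourites. -/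
def crossProg : RamProg :=
  forLoop varI .numAgents <| forLoop varJ .numAgents <|
    .ite (.natLe (var varI) (var varJ)) .skip crossStep

theorem runs_crossProg {X : RamInput} (hX : Valid X) (s : RamState) :
    Runs X crossProg s fun s' => ∀ a < X.numAgents, ∀ b < a,
      CrossSplit X (s'.nat tblCross 0) a b := by
  refine .forLoop X.numAgents (fun k s' => ∀ a < k, ∀ b < a, CrossSplit X (s'.nat tblCross 0) a b)
    (by omega) (fun _ => rfl) rfl (fun k s' x h => by simpa [writeNat_nat_of_ne] using h) (by simp)
    ?_ (fun _ _ h => h)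
  intro i hi s1 a1 hi1 hI
  refine .forLoop X.numAgents (fun j s' =>
      (∀ a < i, ∀ b < a, CrossSplit X (s'.nat tblCross 0) a b) ∧ ∀ b < j,
        b < i → CrossSplit X (s'.nat tblCross 0) i b)
    (by omega) (fun _ => rfl) rfl (fun k s' x h => by simpa [writeNat_nat_of_ne] using h)
    ⟨hI, by simp⟩ ?_ (fun s' _ h a ha b hb => ?_)
  · intro j hj s2 a2 hj2 ⟨h1, h2⟩
    have hi2 : s2.nat varI 0 0 = i := by rw [a2.nat varI rfl, hi1]
    refine .ite (fun ht => .skip ⟨h1, fun b hb hbi => ?_⟩) (fun ht => ?_) <;>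
      simp only [holds_natLe, NatExpr.eval, hi2, hj2] at ht
    · exact h2 b (by omega) hbi
    · refine (runs_crossStep hX s2 hi2 hj2 (by omega)).imp fun s3 ⟨h3, h4⟩ => ?_
      have hne : ∀ a b, b < a → ¬ (a = i ∧ b = j) → ∀ e ∈ between X a b,
          s2.nat tblCross 0 e = s3.nat tblCross 0 e := by
        intro a b hba hab e he
        refine (h4 e fun hje => hab ?_).symm
        have := (mem_between.1 he).2
        unfold Joins at hje this
        omega
      refine ⟨fun a ha b hb => (h1 a ha b hb).congr (hne a b hb (by omega)), fun b hb hbi => ?_⟩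
      rcases Nat.lt_succ_iff_lt_or_eq.1 hb with hb | rfl
      · exact (h2 b hb hbi).congr (hne i b hbi (by omega))
      · exact h3
  · rcases Nat.lt_succ_iff_lt_or_eq.1 ha with ha | rfl
    · exact h.1 a ha b hb
    · exact h.2 b (by omega) hb

/-! ### The owners of the items -/

open Classical in
/-- The owner of the item `e` between `a` and `b`.  If one of the two points to the other and is not
a starting agent, the split of the edges for this pointer applies, and `act` tells in which of the
two ways. -/
noncomputable def ownerOf (T : ℕ → ℕ) (act : ℕ → Prop) (take keep : ℕ → ℕ → ℕ) (cross : ℕ → ℕ)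
    (a b e : ℕ) : ℕ :=
  if T b = a ∧ ¬ IsStart T b then (if act b then take b e else keep b e)
  else if T a = b ∧ ¬ IsStart T a then (if act a then take a e else keep a e)
  else cross e

/-- The test whether agent `c` points to agent `p` and is not a starting agent. -/
def childTest (p c : NatExpr) : RamTest := .and (eqTest (entry tblPt c) p) (.not (startTest c))

/-- Assign the item in `varE` according to the pointer of agent `c`. -/
def assignChild (c : NatExpr) : RamProg :=
  .ite (eqTest (.cell tblAct .numAgents c) (.const 1))
    (setEntry tblOwner (var varE) (.cell tblTake c (var varE)))
    (setEntry tblOwner (var varE) (.cell tblKeep c (var varE)))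

/-- Assign all items. -/
def ownerProg : RamProg :=
  forLoop varE .numItems <|
    .ite (childTest (.endA (var varE)) (.endB (var varE))) (assignChild (.endB (var varE))) <|
    .ite (childTest (.endB (var varE)) (.endA (var varE))) (assignChild (.endA (var varE)))
      (setEntry tblOwner (var varE) (entry tblCross (var varE)))

theorem runs_ownerProg {X : RamInput} (s : RamState) :
    Runs X ownerProg s fun s' => ∀ e < X.numItems, s'.nat tblOwner 0 e =
      ownerOf (s.nat tblPt 0) (fun l => s.nat tblAct X.numAgents l = 1) (s.nat tblTake)
        (s.nat tblKeep) (s.nat tblCross 0) (X.endA e) (X.endB e) e := by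
  refine .forLoop X.numItems (fun k s' => ∀ e < k, s'.nat tblOwner 0 e =
      ownerOf (s.nat tblPt 0) (fun l => s.nat tblAct X.numAgents l = 1) (s.nat tblTake)
        (s.nat tblKeep) (s.nat tblCross 0) (X.endA e) (X.endB e) e) (by omega) (fun _ => rfl) rfl
    (fun k s' x h => by simpa [writeNat_nat_of_ne] using h) (by simp) ?_ (fun _ _ h => h)
  intro k hk s' ha hkc hI
  have kP := ha.nat tblPt rfl
  have kA := ha.nat tblAct rfl
  have kT := ha.nat tblTake rfl
  have kK := ha.nat tblKeep rfl
  have kC := ha.nat tblCross rfl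
  have done : ∀ z, z = ownerOf (s.nat tblPt 0) (fun l => s.nat tblAct X.numAgents l = 1)
        (s.nat tblTake) (s.nat tblKeep) (s.nat tblCross 0) (X.endA k) (X.endB k) k →
      ∀ e < k + 1, (s'.writeNat tblOwner 0 k z).nat tblOwner 0 e =
        ownerOf (s.nat tblPt 0) (fun l => s.nat tblAct X.numAgents l = 1) (s.nat tblTake)
          (s.nat tblKeep) (s.nat tblCross 0) (X.endA e) (X.endB e) e := by
    intro z hz e he
    rw [writeNat_row]
    rcases Nat.lt_succ_iff_lt_or_eq.1 he with he | rfl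
    · rw [Function.update_of_ne (by omega), hI e he]
    · rw [Function.update_self, hz]
  refine .ite (fun h1 => .ite (fun h2 => .setNat ?_) (fun h2 => .setNat ?_)) (fun h1 =>
      .ite (fun h3 => .ite (fun h2 => .setNat ?_) (fun h2 => .setNat ?_))
        (fun h3 => .setNat ?_)) <;>
    simp only [childTest, holds_and, holds_not, holds_eq, holds_startTest, NatExpr.eval, hkc, kP,
      kA, kT, kK, kC] at * <;>
    refine done _ ?_ <;> unfold ownerOf
  · rw [if_pos h1, if_pos h2]
  · rw [if_pos h1, if_neg h2]
  · rw [if_neg h1, if_pos h3, if_pos h2]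
  · rw [if_neg h1, if_pos h3, if_neg h2]
  · rw [if_neg h1, if_neg h3]

/-! ### The values of the bundles -/

/-- Compute the value of every bundle for every agent. -/
def valProg : RamProg :=
  forLoop varI .numAgents <| forLoop varE .numItems <|
    .setReal tblVal (var varI) (entry tblOwner (var varE))
      (.add (.cell tblVal (var varI) (entry tblOwner (var varE))) (.value (var varI) (var varE)))

/-- The value for agent `i` of the items that `b` owns. -/
noncomputable def worth (X : RamInput) (own : ℕ → ℕ) (i b : ℕ) : ℝ :=
  ∑ e ∈ (Finset.range X.numItems).filter (fun e => own e = b), X.value i e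

theorem runs_valProg {X : RamInput} (s : RamState) (h0 : ∀ i b, s.real tblVal i b = 0) :
    Runs X valProg s fun s' => ∀ i < X.numAgents, ∀ b,
      s'.real tblVal i b = worth X (s.nat tblOwner 0) i b := by
  set own := s.nat tblOwner 0 with hown
  refine .forLoop X.numAgents (fun k s' => (∀ i < k, ∀ b, s'.real tblVal i b = worth X own i b) ∧
      ∀ i ≥ k, ∀ b, s'.real tblVal i b = 0) (by omega) (fun _ => rfl) rfl
    (fun k s' x h => by simpa using h) (by simp [h0]) ?_ (fun _ _ h => h.1)
  intro i hi s1 a1 hi1 ⟨h1, h2⟩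
  refine .forLoop X.numItems (fun k s' => (∀ i' < i, ∀ b, s'.real tblVal i' b = worth X own i' b) ∧
      (∀ b, s'.real tblVal i b =
        ∑ e ∈ (Finset.range k).filter (fun e => own e = b), X.value i e) ∧
      ∀ i' > i, ∀ b, s'.real tblVal i' b = 0) (by omega) (fun _ => rfl) rfl
    (fun k s' x h => by simpa using h)
    ⟨h1, fun b => by simpa using h2 i le_rfl b, fun i' hi' => h2 i' (by omega)⟩ ?_ ?_
  · intro k hk s2 a2 hk2 ⟨h3, h4, h5⟩
    have kO : s2.nat tblOwner 0 = own := by rw [a2.nat tblOwner rfl, a1.nat tblOwner rfl]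
    have kI : s2.nat varI 0 0 = i := by rw [a2.nat varI rfl, hi1]
    refine .setReal ?_
    simp only [NatExpr.eval, RealExpr.eval, kO, kI, hk2]
    refine ⟨fun i' hi' b => ?_, fun b => ?_, fun i' hi' b => ?_⟩
    · rw [writeReal_real, if_neg (by omega), h3 i' hi']
    · rw [writeReal_real, Finset.range_add_one, Finset.filter_insert]
      by_cases hb : own k = b
      · rw [if_pos ⟨rfl, rfl, hb.symm⟩, if_pos hb, Finset.sum_insert (by simp), h4, hb, add_comm]
      · rw [if_neg (by tauto), if_neg hb, h4]
    · rw [writeReal_real, if_neg (by omega), h5 i' hi']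
  · intro s2 a2 ⟨h3, h4, h5⟩
    refine ⟨fun i' hi' b => ?_, fun i' hi' => h5 i' (by omega)⟩
    rcases Nat.lt_succ_iff_lt_or_eq.1 hi' with hi' | rfl
    · exact h3 i' hi' b
    · exact h4 b

/-! ### The payments -/

/-- The maximum of `0` and the first `k` values of `f`. -/
noncomputable def partialMax (f : ℕ → ℝ) : ℕ → ℝ
  | 0 => 0
  | k + 1 => max (partialMax f k) (f k)

theorem partialMax_nonneg (f : ℕ → ℝ) (k : ℕ) : 0 ≤ partialMax f k := by
  induction k with
  | zero => exact le_rfl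
  | succ k ih => exact le_max_of_le_left ih

theorem le_partialMax (f : ℕ → ℝ) {k j : ℕ} (hj : j < k) : f j ≤ partialMax f k := by
  induction k with
  | zero => omega
  | succ k ih =>
    rcases Nat.lt_succ_iff_lt_or_eq.1 hj with hj | rfl
    · exact le_max_of_le_left (ih hj)
    · exact le_max_right _ _

theorem partialMax_attained (f : ℕ → ℝ) (k : ℕ) :
    partialMax f k = 0 ∨ ∃ j < k, partialMax f k = f j := by
  induction k with
  | zero => exact Or.inl rfl
  | succ k ih =>
    rcases max_choice (partialMax f k) (f k) with h | h
    · rcases ih with h' | ⟨j, hj, h'⟩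
      · exact Or.inl (h.trans h')
      · exact Or.inr ⟨j, by omega, h.trans h'⟩
    · exact Or.inr ⟨k, by omega, h⟩

/-- The payments after `k` rounds of relaxation. -/
noncomputable def payRound (n : ℕ) (w : ℕ → ℕ → ℝ) : ℕ → ℕ → ℝ
  | 0, _ => 0
  | k + 1, a => partialMax (fun b => w a b + payRound n w k b) n

theorem isRelaxation_payRound (n : ℕ) (w : ℕ → ℕ → ℝ) :
    IsRelaxation (fun a b : Fin n => w a b) fun k a => payRound n w k a where
  zero _ := rfl
  nonneg k a := by
    cases k with
    | zero => exact le_rfl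
    | succ k => exact partialMax_nonneg _ _
  le_succ k a b := le_partialMax (fun b => w a b + payRound n w k b) b.2
  attained k a := by
    rcases partialMax_attained (fun b => w a b + payRound n w k b) n with h | ⟨j, hj, h⟩
    · exact Or.inl h
    · exact Or.inr ⟨⟨j, hj⟩, h⟩

theorem partialMax_congr {f f' : ℕ → ℝ} {k : ℕ} (h : ∀ j < k, f j = f' j) :
    partialMax f k = partialMax f' k := by
  induction k with
  | zero => rfl
  | succ k ih => rw [partialMax, partialMax, ih fun j hj => h j (by omega), h k (by omega)]

theorem payRound_congr {n : ℕ} {w w' : ℕ → ℕ → ℝ} (h : ∀ a < n, ∀ b < n, w a b = w' a b) (k : ℕ) :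
    ∀ a < n, payRound n w k a = payRound n w' k a := by
  induction k with
  | zero => exact fun _ _ => rfl
  | succ k ih => exact fun a ha => partialMax_congr fun b hb => by rw [h a ha b hb, ih b hb]

/-- The payment that agent `varI` needs not to envy `varJ`, if this agent is paid as in row
`varK`. -/
def needExpr : RealExpr :=
  .add (.sub (.cell tblVal (var varI) (var varJ)) (.cell tblVal (var varI) (var varI)))
    (.cell tblRound (var varK) (var varJ))

/-- Row `k` of the table receives the payments after `k` rounds of relaxation. -/
def payProg : RamProg :=
  forLoop varK .numAgents <| forLoop varI .numAgents <| forLoop varJ .numAgents <|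
    .ite (.realLe (.cell tblRound (.add (var varK) (.const 1)) (var varI)) needExpr)
      (.setReal tblRound (.add (var varK) (.const 1)) (var varI) needExpr) .skip

theorem runs_payProg {X : RamInput} (s : RamState) (h0 : ∀ k a, s.real tblRound k a = 0) :
    Runs X payProg s fun s' => ∀ a < X.numAgents, s'.real tblRound X.numAgents a =
      payRound X.numAgents (fun a b => s.real tblVal a b - s.real tblVal a a) X.numAgents a := by
  set w : ℕ → ℕ → ℝ := fun a b => s.real tblVal a b - s.real tblVal a a with hw
  set n := X.numAgents with hn
  refine .forLoop n (fun k s' => (∀ a < n, s'.real tblRound k a = payRound n w k a) ∧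
      ∀ j > k, ∀ a, s'.real tblRound j a = 0) (by omega) (fun _ => rfl) rfl
    (fun k s' x h => by simpa using h) (by simp [h0, payRound]) ?_ (fun _ _ h => h.1)
  intro k hk s1 a1 hk1 ⟨h1, h2⟩
  refine .forLoop n (fun i s' => (∀ a < n, s'.real tblRound k a = payRound n w k a) ∧
      (∀ a < i, s'.real tblRound (k + 1) a = payRound n w (k + 1) a) ∧
      (∀ a ≥ i, s'.real tblRound (k + 1) a = 0) ∧
      ∀ j > k + 1, ∀ a, s'.real tblRound j a = 0) (by omega) (fun _ => rfl) rfl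
    (fun k s' x h => by simpa using h)
    ⟨h1, by simp, fun a _ => h2 _ (by omega) a, fun j hj => h2 j (by omega)⟩ ?_
    (fun _ _ h => ⟨h.2.1, h.2.2.2⟩)
  intro i hi s2 a2 hi2 ⟨h3, h4, h5, h6⟩
  refine .forLoop n (fun j s' => (∀ a < n, s'.real tblRound k a = payRound n w k a) ∧
      (∀ a < i, s'.real tblRound (k + 1) a = payRound n w (k + 1) a) ∧
      s'.real tblRound (k + 1) i = partialMax (fun b => w i b + payRound n w k b) j ∧
      (∀ a > i, s'.real tblRound (k + 1) a = 0) ∧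
      ∀ j > k + 1, ∀ a, s'.real tblRound j a = 0) (by omega) (fun _ => rfl) rfl
    (fun k s' x h => by simpa using h)
    ⟨h3, h4, h5 i le_rfl, fun a ha => h5 a (by omega), h6⟩ ?_ ?_
  · intro j hj s3 a3 hj3 ⟨h7, h8, h9, h10, h11⟩
    have kV : s3.real tblVal = s.real tblVal :=
      ((a3.real tblVal rfl).trans (a2.real tblVal rfl)).trans (a1.real tblVal rfl)
    have kI : s3.nat varI 0 0 = i := by rw [a3.nat varI rfl, hi2]
    have kK : s3.nat varK 0 0 = k := by rw [a3.nat varK rfl, a2.nat varK rfl, hk1]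
    have hneed : needExpr.eval X s3 = w i j + payRound n w k j := by
      simp [needExpr, kV, kI, kK, hj3, hw, h7 j hj]
    refine .ite (fun ht => .setReal ?_) (fun ht => .skip ⟨h7, h8, ?_, h10, h11⟩) <;>
      simp only [holds_realLe, RealExpr.eval, NatExpr.eval, hneed, kI, kK, h9] at ht ⊢
    · refine ⟨fun a ha => ?_, fun a ha => ?_, ?_, fun a ha => ?_, fun l hl a => ?_⟩
      · rw [writeReal_real, if_neg (by omega), h7 a ha]
      · rw [writeReal_real, if_neg (by omega), h8 a ha]
      · rw [writeReal_real, if_pos ⟨rfl, rfl, rfl⟩]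
        exact (max_eq_right ht).symm
      · rw [writeReal_real, if_neg (by omega), h10 a ha]
      · rw [writeReal_real, if_neg (by omega), h11 l hl]
    · exact (max_eq_left (le_of_not_ge ht)).symm
  · intro s3 a3 ⟨h7, h8, h9, h10, h11⟩
    refine ⟨h7, fun a ha => ?_, fun a ha => h10 a (by omega), h11⟩
    rcases Nat.lt_succ_iff_lt_or_eq.1 ha with ha | rfl
    · exact h8 a ha
    · exact h9

/-- Copy the payments of the last round to the output. -/
def outProg : RamProg :=
  forLoop varI .numAgents <|
    .setReal tblPay (.const 0) (var varI) (.cell tblRound .numAgents (var varI))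

theorem runs_outProg {X : RamInput} (s : RamState) :
    Runs X outProg s fun s' => ∀ a < X.numAgents,
      s'.real tblPay 0 a = s.real tblRound X.numAgents a := by
  refine .forLoop X.numAgents (fun k s' => ∀ a < k,
      s'.real tblPay 0 a = s.real tblRound X.numAgents a) (by omega) (fun _ => rfl) rfl
    (fun k s' x h => by simpa using h) (by simp) ?_ (fun _ _ h => h)
  intro k hk s' ha hkc hI
  refine .setReal ?_
  intro a hak
  simp only [NatExpr.eval, RealExpr.eval, hkc, ha.real tblRound rfl, writeReal_real]
  rcases Nat.lt_succ_iff_lt_or_eq.1 hak with hak | rfl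
  · rw [if_neg (by omega), hI a hak]
  · simp

/-! ### The whole program -/

/-- Compute an envy-free orientation with payments. -/
def orientProg : RamProg :=
  .seq favProg <| .seq childProg <| .seq bestProg <| .seq actProg <| .seq crossProg <|
  .seq ownerProg <| .seq valProg <| .seq payProg outProg

/-- A description of the owners `own` of the items: `F` and `T` give the favourite edges and their
other endpoints, `M` marks the children whose favourite edges are to be taken if possible, `best`
gives the best one of each agent, and `take`, `keep` and `cross` are the splits of the pairs of
agents. -/
structure Plan (X : RamInput) (T F M best : ℕ → ℕ) (take keep : ℕ → ℕ → ℕ) (cross own : ℕ → ℕ) :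
    Prop where
  fav : ∀ l < X.numAgents, IsFav X l (T l) (F l)
  child : ∀ l < X.numAgents, ∃ P Q, ChildSplit X (T l) l (F l) P Q (M l = 1) (take l) (keep l)
  isBest : ∀ a, IsBest X T F M X.numAgents a (best a)
  isCross : ∀ a < X.numAgents, ∀ b < a, CrossSplit X cross a b
  own_eq : ∀ e < X.numItems, own e = ownerOf T (Reached T best X.numAgents) take keep cross
    (X.endA e) (X.endB e) e

theorem ownerOf_congr {T : ℕ → ℕ} {act act' : ℕ → Prop} {take keep : ℕ → ℕ → ℕ} {cross : ℕ → ℕ}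
    {a b e : ℕ} (ha : act a ↔ act' a) (hb : act b ↔ act' b) :
    ownerOf T act take keep cross a b e = ownerOf T act' take keep cross a b e := by
  unfold ownerOf
  split_ifs <;> first | rfl | (exfalso; tauto)

theorem runs_orientProg {X : RamInput} (hX : Valid X) :
    Runs X orientProg .init fun s' => (∃ T F M best take keep cross,
      Plan X T F M best take keep cross (s'.nat tblOwner 0)) ∧
      ∀ a < X.numAgents, s'.real tblPay 0 a = payRound X.numAgents
        (fun a b => worth X (s'.nat tblOwner 0) a b - worth X (s'.nat tblOwner 0) a a)
        X.numAgents a := by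
  refine .seq ((runs_favProg hX _).imp_agree fun s1 h1 a1 => ?_)
  refine .seq ((runs_childProg hX _).imp_agree fun s2 h2 a2 => ?_)
  refine .seq ((runs_bestProg _ fun a => ?_).imp_agree fun s3 h3 a3 => ?_)
  · rw [a2.nat tblBest rfl, a1.nat tblBest rfl]; rfl
  refine .seq ((runs_actProg _ (fun k l => ?_) fun l hl => ?_).imp_agree fun s4 h4 a4 => ?_)
  · rw [a3.nat tblAct rfl, a2.nat tblAct rfl, a1.nat tblAct rfl]; rfl
  · rw [a3.nat tblPt rfl, a2.nat tblPt rfl]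
    obtain ⟨h5, -, h6⟩ := h1 l hl
    rcases h6 with h6 | h6
    · exact h6.1 ▸ hX.endA_lt _ h5
    · exact h6.2 ▸ hX.endB_lt _ h5
  refine .seq ((runs_crossProg hX _).imp_agree fun s5 h5 a5 => ?_)
  refine .seq ((runs_ownerProg _).imp_agree fun s6 h6 a6 => ?_)
  refine .seq ((runs_valProg _ fun i b => ?_).imp_agree fun s7 h7 a7 => ?_)
  · rw [a6.real tblVal rfl, a5.real tblVal rfl, a4.real tblVal rfl, a3.real tblVal rfl,
      a2.real tblVal rfl, a1.real tblVal rfl]; rfl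
  refine .seq ((runs_payProg _ fun k a => ?_).imp_agree fun s8 h8 a8 => ?_)
  · rw [a7.real tblRound rfl, a6.real tblRound rfl, a5.real tblRound rfl, a4.real tblRound rfl,
      a3.real tblRound rfl, a2.real tblRound rfl, a1.real tblRound rfl]; rfl
  refine (runs_outProg _).imp_agree fun s9 h9 a9 => ?_
  have eP5 : s5.nat tblPt = s1.nat tblPt := by
    rw [a5.nat tblPt rfl, a4.nat tblPt rfl, a3.nat tblPt rfl, a2.nat tblPt rfl]
  have eO9 : s9.nat tblOwner = s6.nat tblOwner := by
    rw [a9.nat tblOwner rfl, a8.nat tblOwner rfl, a7.nat tblOwner rfl]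
  rw [a3.nat tblPt rfl, a2.nat tblPt rfl] at h4
  rw [a2.nat tblPt rfl, a2.nat tblFav rfl] at h3
  rw [eP5, a5.nat tblAct rfl, a5.nat tblTake rfl, a5.nat tblKeep rfl, a4.nat tblTake rfl,
    a4.nat tblKeep rfl, a3.nat tblTake rfl, a3.nat tblKeep rfl] at h6
  rw [eO9]
  refine ⟨⟨s1.nat tblPt 0, s1.nat tblFav 0, s2.nat tblMove 0, s3.nat tblBest 0, s2.nat tblTake,
    s2.nat tblKeep, s5.nat tblCross 0, h1, h2, h3, h5, fun e he => ?_⟩, fun a ha => ?_⟩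
  · rw [h6 e he]
    exact ownerOf_congr (h4 _ (hX.endA_lt e he)) (h4 _ (hX.endB_lt e he))
  · rw [h9 a ha, h8 a ha]
    exact payRound_congr (fun a ha b _ => by rw [h7 a ha, h7 a ha]) _ a ha

/-! ### The computed orientation -/

theorem CrossSplit.symm {X : RamInput} {own : ℕ → ℕ} {a b : ℕ} (h : CrossSplit X own a b) :
    CrossSplit X own b a where
  own_eq e he := (h.own_eq e (by rwa [between_comm])).symm
  le_left := by simpa only [share_comm X own _ b a] using h.le_right
  le_right := by simpa only [share_comm X own _ b a] using h.le_left
  welfare := by simpa only [share_comm X own _ b a, add_comm] using h.welfare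

theorem share_of_ite {X : RamInput} {own : ℕ → ℕ} {a b c d : ℕ} {S : Finset ℕ}
    (hS : S ⊆ between X a b) (hcd : c ≠ d)
    (h : ∀ e ∈ between X a b, own e = if e ∈ S then c else d) (i : ℕ) :
    share X own i a b c = ∑ e ∈ S, X.value i e ∧
      share X own i a b d = ∑ e ∈ between X a b, X.value i e - ∑ e ∈ S, X.value i e := by
  have hc : (between X a b).filter (fun e => own e = c) = S := by
    ext e
    rw [Finset.mem_filter]
    refine ⟨fun ⟨h1, h2⟩ => ?_, fun h1 => ⟨hS h1, by rw [h e (hS h1), if_pos h1]⟩⟩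
    rw [h e h1] at h2
    by_contra h3
    rw [if_neg h3] at h2
    exact hcd h2.symm
  have hd : (between X a b).filter (fun e => own e = d) = between X a b \ S := by
    ext e
    rw [Finset.mem_filter, Finset.mem_sdiff]
    refine and_congr_right fun h1 => ?_
    rw [h e h1]
    split_ifs with h3 <;> simp [h3, hcd]
  refine ⟨by rw [share, hc], ?_⟩
  rw [share, hd, Finset.sum_sdiff_eq_sub hS]

namespace Plan

variable {X : RamInput} {T F M best : ℕ → ℕ} {take keep : ℕ → ℕ → ℕ} {cross own : ℕ → ℕ}

theorem pt_lt (hX : Valid X) (H : Plan X T F M best take keep cross own) {l : ℕ}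
    (hl : l < X.numAgents) : T l < X.numAgents := by
  obtain ⟨h1, -, h2⟩ := H.fav l hl
  rcases h2 with h2 | h2
  · exact h2.1 ▸ hX.endA_lt _ h1
  · exact h2.2 ▸ hX.endB_lt _ h1

theorem pt_ne (hX : Valid X) (H : Plan X T F M best take keep cross own) {l : ℕ}
    (hl : l < X.numAgents) : T l ≠ l := by
  obtain ⟨h1, -, h2⟩ := H.fav l hl
  have := hX.endA_ne_endB _ h1
  unfold Joins at h2
  omega

theorem fav_mem (H : Plan X T F M best take keep cross own) {l : ℕ} (hl : l < X.numAgents) :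
    F l ∈ between X (T l) l :=
  mem_between.2 ⟨(H.fav l hl).1, (H.fav l hl).2.2⟩

theorem own_child (H : Plan X T F M best take keep cross own) {l : ℕ}
    (hs : ¬ IsStart T l) {e : ℕ} (he : e ∈ between X (T l) l) :
    (Reached T best X.numAgents l → own e = take l e) ∧
      (¬ Reached T best X.numAgents l → own e = keep l e) := by
  obtain ⟨h1, h2⟩ := mem_between.1 he
  rw [H.own_eq e h1]
  unfold ownerOf
  rcases h2 with ⟨h2, h3⟩ | ⟨h2, h3⟩
  · rw [h2, h3, if_pos ⟨rfl, hs⟩]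
    exact ⟨fun h => if_pos h, fun h => if_neg h⟩
  · rw [h2, h3]
    by_cases hts : T (T l) = l ∧ ¬ IsStart T (T l)
    · -- of two agents who point to each other, one is a starting agent
      have hl : T l = l := by
        have h4 := hts.2
        unfold IsStart at h4 hs
        rw [hts.1] at h4 hs
        have h5 : ¬ T l < l := fun h => h4 ⟨rfl, h⟩
        have h6 : ¬ l < T l := fun h => hs ⟨rfl, h⟩
        omega
      rw [if_pos hts, hl]
      exact ⟨fun h => if_pos h, fun h => if_neg h⟩
    · rw [if_neg hts, if_pos ⟨rfl, hs⟩]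
      exact ⟨fun h => if_pos h, fun h => if_neg h⟩

theorem own_cross (H : Plan X T F M best take keep cross own) {a b : ℕ}
    (h1 : ¬ (T b = a ∧ ¬ IsStart T b)) (h2 : ¬ (T a = b ∧ ¬ IsStart T a)) {e : ℕ}
    (he : e ∈ between X a b) : cross e = own e := by
  obtain ⟨h3, h4⟩ := mem_between.1 he
  rw [H.own_eq e h3]
  unfold ownerOf
  rcases h4 with ⟨h4, h5⟩ | ⟨h4, h5⟩
  · rw [h4, h5, if_neg h1, if_neg h2]
  · rw [h4, h5, if_neg h2, if_neg h1]

theorem crossSplit (H : Plan X T F M best take keep cross own) {a b : ℕ}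
    (ha : a < X.numAgents) (hb : b < X.numAgents) (hab : a ≠ b)
    (h1 : ¬ (T b = a ∧ ¬ IsStart T b)) (h2 : ¬ (T a = b ∧ ¬ IsStart T a)) :
    CrossSplit X own a b := by
  rcases lt_or_gt_of_ne hab with h | h
  · exact ((H.isCross b hb a h).symm).congr fun e he => H.own_cross h1 h2 he
  · exact (H.isCross a ha b h).congr fun e he => H.own_cross h1 h2 he

theorem own_eq_child_or (H : Plan X T F M best take keep cross own) {l : ℕ}
    (hl : l < X.numAgents) (hs : ¬ IsStart T l) {e : ℕ} (he : e ∈ between X (T l) l) :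
    own e = T l ∨ own e = l := by
  obtain ⟨P, Q, hPQ⟩ := H.child l hl
  have h := H.own_child hs he
  by_cases hr : Reached T best X.numAgents l
  · rw [h.1 hr, hPQ.take_eq e he]
    split_ifs <;> simp
  · rw [h.2 hr]
    rcases hPQ.keep_eq with ⟨-, h'⟩ | ⟨-, h'⟩ <;> rw [h' e he] <;> split_ifs <;> simp

/-- Every item is given to one of its endpoints. -/
theorem own_eq_end (hX : Valid X) (H : Plan X T F M best take keep cross own) {e : ℕ}
    (he : e < X.numItems) : own e = X.endA e ∨ own e = X.endB e := by
  have hb : e ∈ between X (X.endA e) (X.endB e) := mem_between.2 ⟨he, Or.inl ⟨rfl, rfl⟩⟩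
  by_cases h1 : T (X.endB e) = X.endA e ∧ ¬ IsStart T (X.endB e)
  · have := H.own_eq_child_or (hX.endB_lt e he) h1.2 (e := e) (by rwa [h1.1])
    rwa [h1.1] at this
  by_cases h2 : T (X.endA e) = X.endB e ∧ ¬ IsStart T (X.endA e)
  · have := H.own_eq_child_or (hX.endA_lt e he) h2.2 (e := e) (by rwa [h2.1, between_comm])
    rw [h2.1] at this
    exact this.symm
  exact (H.crossSplit (hX.endA_lt e he) (hX.endB_lt e he) (hX.endA_ne_endB e he) h1 h2).own_eq e hb

theorem sum_between (H : Plan X T F M best take keep cross own) {l : ℕ} (hl : l < X.numAgents)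
    {P Q : Finset ℕ} {move : Prop} {tk kp : ℕ → ℕ}
    (hPQ : ChildSplit X (T l) l (F l) P Q move tk kp) (i : ℕ) :
    ∑ e ∈ between X (T l) l, X.value i e =
      X.value i (F l) + ∑ e ∈ P, X.value i e + ∑ e ∈ Q, X.value i e := by
  rw [← Finset.add_sum_erase _ _ (H.fav_mem hl), ← hPQ.union, Finset.sum_union hPQ.disj, add_assoc]

theorem best_of_reached (hX : Valid X) (H : Plan X T F M best take keep cross own) {l : ℕ}
    (hl : l < X.numAgents) (h : Reached T best X.numAgents l) (hs : ¬ IsStart T l) :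
    Reached T best X.numAgents (T l) ∧ best (T l) = l + 1 :=
  ((reached_stable (fun _ h => H.pt_lt hX h) hl).1 h).resolve_left hs

theorem move_of_reached (hX : Valid X) (H : Plan X T F M best take keep cross own) {l : ℕ}
    (hl : l < X.numAgents) (h : Reached T best X.numAgents l) (hs : ¬ IsStart T l) : M l = 1 := by
  have hb := (H.best_of_reached hX hl h hs).2
  rcases H.isBest (T l) with ⟨h1, -⟩ | ⟨j, -, h1, -, -, h2, -⟩
  · omega
  · obtain rfl : j = l := by omega
    exact h2

/-- The values of the shares in the computed orientation satisfy the inequalities of a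
`PairSplit`. -/
theorem exists_pairSplit (hX : Valid X) (H : Plan X T F M best take keep cross own) :
    ∃ (t : Fin X.numAgents → Fin X.numAgents) (start moved : Fin X.numAgents → Prop)
      (x pl ql pc qc : Fin X.numAgents → ℝ),
      PairSplit t start moved x pl ql pc qc (fun a b => share X own a a b a)
        (fun a b => share X own a a b b) := by
  have hchild := H.child
  choose! P Q hPQ using hchild
  have hnn : ∀ i S, 0 ≤ ∑ e ∈ S, X.value i e := fun i S =>
    Finset.sum_nonneg fun e _ => hX.value_nonneg i e
  have hreach := fun {l} (hl : l < X.numAgents) =>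
    reached_stable (T := T) (best := best) (fun _ h => H.pt_lt hX h) hl
  have hval : ∀ l < X.numAgents, X.value l (F l) = 1 := fun l hl =>
    le_antisymm (hX.value_le _ _) (H.fav l hl).2.1
  have hP : ∀ l < X.numAgents, P l ⊆ between X (T l) l := fun l hl e he =>
    Finset.mem_of_mem_erase ((hPQ l hl).union ▸ Finset.mem_union_left _ he)
  have hQ : ∀ l < X.numAgents, Q l ⊆ between X (T l) l := fun l hl e he =>
    Finset.mem_of_mem_erase ((hPQ l hl).union ▸ Finset.mem_union_right _ he)
  refine ⟨fun l => ⟨T l, H.pt_lt hX l.2⟩, fun l => IsStart T l,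
    fun l => Reached T best X.numAgents l ∧ ¬ IsStart T l, fun l => X.value (T l) (F l),
    fun l => ∑ e ∈ P l, X.value (T l) e, fun l => ∑ e ∈ Q l, X.value (T l) e,
    fun l => ∑ e ∈ P l, X.value l e, fun l => ∑ e ∈ Q l, X.value l e, ?_⟩
  have not_both : ∀ l : ℕ, IsStart T l → ¬ IsStart T (T l) := by
    intro l ⟨h1, h2⟩ ⟨_, h4⟩
    rw [h1] at h4
    omega
  constructor
  case t_ne => exact fun l h => H.pt_ne hX l.2 (congrArg Fin.val h)
  case start_mutual => exact fun l h => Fin.ext h.1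
  case not_start_partner => exact fun l h => not_both l h
  case start_of_mutual =>
    intro l h
    have h1 : T (T l) = l := congrArg Fin.val h
    rcases lt_or_gt_of_ne (H.pt_ne hX l.2) with h2 | h2
    · exact Or.inr ⟨by rw [h1], by rw [h1]; exact h2⟩
    · exact Or.inl ⟨h1, h2⟩
  case not_start_of_moved => exact fun l h => h.2
  case active_of_moved =>
    intro l h
    have := (H.best_of_reached hX l.2 h.1 h.2).1
    by_cases hs : IsStart T (T l)
    · exact Or.inl hs
    · exact Or.inr ⟨this, hs⟩
  case moved_unique =>
    intro l l' h h' he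
    have h1 := (H.best_of_reached hX l.2 h.1 h.2).2
    have h2 := (H.best_of_reached hX l'.2 h'.1 h'.2).2
    have h3 : T l = T l' := congrArg Fin.val he
    rw [h3, h2] at h1
    exact Fin.ext (by omega)
  case moved_gain =>
    intro l h
    exact (hPQ l l.2).move_iff.1 (H.move_of_reached hX l.2 h.1 h.2)
  case exists_moved =>
    intro l hs hm hact hmv
    have hM : M l = 1 := (hPQ l l.2).move_iff.2 hmv
    have hT : Reached T best X.numAgents (T l) := by
      rcases hact with h | h
      · exact (hreach (H.pt_lt hX l.2)).2 (Or.inl h)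
      · exact h.1
    rcases H.isBest (T l) with ⟨-, h⟩ | ⟨j, hj, h1, h2, h3, -, h4⟩
    · exact absurd hM (h l l.2 rfl hs)
    · refine ⟨⟨j, hj⟩, ⟨(hreach hj).2 (Or.inr ?_), h3⟩, Fin.ext h2, ?_⟩
      · rw [h2]; exact ⟨hT, h1⟩
      · have := h4 l l.2 rfl hs hM
        simpa only [h2] using this
  case g_nonneg => exact fun a b => hnn _ _
  case h_nonneg => exact fun a b => hnn _ _
  case x_nonneg => exact fun l => hX.value_nonneg _ _
  case x_le => exact fun l => hX.value_le _ _
  case pl_nonneg => exact fun l => hnn _ _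
  case ql_nonneg => exact fun l => hnn _ _
  case qc_nonneg => exact fun l => hnn _ _
  case pl_le => exact fun l => (hPQ l l.2).pl_le
  case qc_le => exact fun l => (hPQ l l.2).qc_le
  case pc_le => exact fun l => (hPQ l l.2).pc_le
  case start_fav =>
    intro l h
    have h1 := H.fav_mem l.2
    have hT := H.pt_lt hX l.2
    have h2 : F l ∈ between X (T (T l)) (T l) := by rwa [h.1, between_comm]
    have hv := hval l l.2
    have hsingle : ∀ S : Finset ℕ, F l ∈ S → 1 ≤ ∑ e ∈ S, X.value (T (T l)) e := by
      intro S hS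
      rw [h.1, ← hv]
      exact Finset.single_le_sum (fun e _ => hX.value_nonneg l e) hS
    by_cases hF : F l = F (T l)
    · left
      change X.value (T (T l)) (F (T l)) = 1
      rw [h.1, ← hF, hv]
    · right
      have h3 : F l ∈ P (T l) ∪ Q (T l) := by
        rw [(hPQ _ hT).union]
        exact Finset.mem_erase.2 ⟨hF, h2⟩
      exact (Finset.mem_union.1 h3).imp (hsingle _) (hsingle _)
  case moved_vals =>
    intro l h
    have hs := H.sum_between l.2 (hPQ l l.2)
    have hown : ∀ e ∈ between X (T l) l, own e = if e ∈ P l then (l : ℕ) else T l := fun e he => by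
      rw [(H.own_child h.2 he).1 h.1, (hPQ l l.2).take_eq e he]
    have hsh := share_of_ite (hP l l.2) (H.pt_ne hX l.2).symm hown
    have h1 := hsh (T l)
    have h2 := hsh l
    rw [hs] at h1 h2
    rw [hval l l.2] at h2
    simp only [share_comm X own l l (T l)]
    refine ⟨?_, ?_, ?_, ?_⟩ <;> linarith [h1.1, h1.2, h2.1, h2.2]
  case keep_vals =>
    intro l hst hm
    have hs := H.sum_between l.2 (hPQ l l.2)
    have hr : ¬ Reached T best X.numAgents l := fun h => hm ⟨h, hst⟩
    simp only [share_comm X own l l (T l)]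
    refine (hPQ l l.2).keep_eq.imp ?_ ?_ <;> rintro ⟨hle, hk⟩ <;> refine ⟨hle, ?_⟩
    · have hown : ∀ e ∈ between X (T l) l, own e = if e ∈ Q l then T l else (l : ℕ) :=
        fun e he => by rw [(H.own_child hst he).2 hr, hk e he]
      have hsh := share_of_ite (hQ l l.2) (H.pt_ne hX l.2) hown
      have h1 := hsh (T l)
      have h2 := hsh l
      rw [hs] at h1 h2
      rw [hval l l.2] at h2
      refine ⟨?_, ?_, ?_, ?_⟩ <;> linarith [h1.1, h1.2, h2.1, h2.2]
    · have hown : ∀ e ∈ between X (T l) l, own e = if e ∈ P l then T l else (l : ℕ) :=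
        fun e he => by rw [(H.own_child hst he).2 hr, hk e he]
      have hsh := share_of_ite (hP l l.2) (H.pt_ne hX l.2) hown
      have h1 := hsh (T l)
      have h2 := hsh l
      rw [hs] at h1 h2
      rw [hval l l.2] at h2
      refine ⟨?_, ?_, ?_, ?_⟩ <;> linarith [h1.1, h1.2, h2.1, h2.2]
  case cross =>
    intro a b hab h1 h2
    have hne : (a : ℕ) ≠ b := fun h => hab (Fin.ext h)
    have hc := H.crossSplit a.2 b.2 hne (fun h => h1 ⟨Fin.ext h.1, h.2⟩)
      (fun h => h2 ⟨Fin.ext h.1, h.2⟩)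
    refine ⟨hc.le_left, ?_⟩
    simpa only [share_comm X own b b a] using hc.welfare

/-- An agent only values those items of another agent's bundle that join the two of them. -/
theorem worth_eq_share (hX : Valid X) (H : Plan X T F M best take keep cross own) {a b : ℕ}
    (hab : a ≠ b) : worth X own a b = share X own a a b b := by
  unfold worth share
  symm
  refine Finset.sum_subset (fun e he => ?_) fun e he hne => ?_
  · obtain ⟨h1, h2⟩ := Finset.mem_filter.1 he
    exact Finset.mem_filter.2 ⟨Finset.mem_range.2 (mem_between.1 h1).1, h2⟩
  · obtain ⟨h1, h2⟩ := Finset.mem_filter.1 he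
    rw [Finset.mem_range] at h1
    rw [Finset.mem_filter, mem_between] at hne
    have h3 := H.own_eq_end hX h1
    refine hX.value_local a e h1 ?_ ?_ <;>
    · intro h4
      refine hne ⟨⟨h1, ?_⟩, h2⟩
      unfold Joins
      omega

theorem worth_self (hX : Valid X) (H : Plan X T F M best take keep cross own) (a : ℕ) :
    worth X own a a = ∑ d : Fin X.numAgents, share X own a a d a := by
  rw [← Finset.sum_range fun d => share X own a a d a]
  unfold worth
  rw [← Finset.sum_fiberwise_of_maps_to (t := Finset.range X.numAgents)
    (g := fun e => if X.endA e = a then X.endB e else X.endA e)]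
  · refine Finset.sum_congr rfl fun d _ => ?_
    unfold share
    refine Finset.sum_congr ?_ fun _ _ => rfl
    ext e
    simp only [Finset.mem_filter, Finset.mem_range, mem_between, Joins]
    constructor
    · rintro ⟨⟨h1, h2⟩, h3⟩
      have h4 := H.own_eq_end hX h1
      split_ifs at h3 <;> omega
    · rintro ⟨⟨h1, h2⟩, h3⟩
      have h4 := hX.endA_ne_endB e h1
      refine ⟨⟨h1, h3⟩, ?_⟩
      split_ifs <;> omega
  · intro e he
    have h1 := Finset.mem_range.1 (Finset.mem_filter.1 he).1
    rw [Finset.mem_range]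
    split_ifs
    · exact hX.endB_lt e h1
    · exact hX.endA_lt e h1

/-- The computed orientation with the computed payments is envy-free, and the payments are small. -/
theorem payments (hX : Valid X) (H : Plan X T F M best take keep cross own) {p : ℕ → ℝ}
    (hp : ∀ a < X.numAgents, p a = payRound X.numAgents
      (fun a b => worth X own a b - worth X own a a) X.numAgents a) :
    (∀ a < X.numAgents, 0 ≤ p a) ∧
    (∀ a < X.numAgents, ∀ b < X.numAgents, worth X own a b + p b ≤ worth X own a a + p a) ∧
      ∑ a : Fin X.numAgents, p a ≤ (X.numAgents : ℝ) / 2 := by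
  obtain ⟨t, start, moved, x, pl, ql, pc, qc, S⟩ := H.exists_pairSplit hX
  have hR := isRelaxation_payRound X.numAgents fun a b => worth X own a b - worth X own a a
  obtain ⟨h1, h2⟩ := S.payments hR (fun a => sub_self _) fun a b hab => by
    rw [H.worth_eq_share hX fun h => hab (Fin.ext h), H.worth_self hX]
  rw [Fintype.card_fin] at h1 h2
  refine ⟨fun a ha => ?_, fun a ha b hb => ?_, ?_⟩
  · rw [hp a ha]
    exact hR.nonneg X.numAgents ⟨a, ha⟩
  · have := h1 ⟨a, ha⟩ ⟨b, hb⟩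
    rw [hp a ha, hp b hb]
    simp only at this
    linarith
  · rw [Finset.sum_congr rfl fun (a : Fin X.numAgents) _ => hp a a.2]
    exact h2

end Plan

/-! ### Instances as inputs of the program -/

variable {n m : ℕ} {I : OrientationInstance n m}

theorem value_toInput (I : OrientationInstance n m) (i : Fin n) (e : Fin m) :
    I.toInput.value i e = I.v i {e} := by
  simp [OrientationInstance.toInput]

theorem endA_toInput (I : OrientationInstance n m) (e : Fin m) : I.toInput.endA e = I.endA e := by
  simp [OrientationInstance.toInput]

theorem endB_toInput (I : OrientationInstance n m) (e : Fin m) : I.toInput.endB e = I.endB e := by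
  simp [OrientationInstance.toInput]

theorem valid_toInput (hI : I.IsAdditive) : Valid I.toInput := by
  have h0 : ∀ i, I.v i ∅ = 0 := fun i => by rw [hI]; simp
  have hle : ∀ i e, I.v i {e} ≤ 1 := fun i e =>
    (I.v_normalized i).2 ⟨e, ∅, by simp [h0]⟩
  have hval : ∀ i e, I.toInput.value i e = 0 ∨ ∃ (i' : Fin n) (e' : Fin m),
      i = i' ∧ e = e' ∧ I.toInput.value i e = I.v i' {e'} := by
    intro i e
    by_cases h : i < n ∧ e < m
    · exact Or.inr ⟨⟨i, h.1⟩, ⟨e, h.2⟩, rfl, rfl, value_toInput I ⟨i, h.1⟩ ⟨e, h.2⟩⟩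
    · exact Or.inl (dif_neg h)
  refine ⟨fun e he => ?_, fun e he => ?_, fun e he h => ?_, fun i e => ?_, fun i e => ?_,
    fun i e he => ?_, fun i e he h1 h2 => ?_, fun i hi => ?_⟩
  · have := endA_toInput I ⟨e, he⟩
    simp only at this
    rw [this]
    exact (I.endA _).2
  · have := endB_toInput I ⟨e, he⟩
    simp only at this
    rw [this]
    exact (I.endB _).2
  · have h1 := endA_toInput I ⟨e, he⟩
    have h2 := endB_toInput I ⟨e, he⟩
    simp only at h1 h2
    rw [h1, h2] at h
    exact I.loopless _ (Fin.ext h)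
  · rcases hval i e with h | ⟨i', e', -, -, h⟩ <;> rw [h]
    exact I.v_nonneg _ _
  · rcases hval i e with h | ⟨i', e', -, -, h⟩ <;> rw [h]
    · exact zero_le_one
    · exact hle _ _
  · exact dif_neg fun h => absurd h.2 (not_lt.2 he)
  · rcases hval i e with h | ⟨i', e', rfl, rfl, h⟩
    · exact h
    · rw [endA_toInput] at h1
      rw [endB_toInput] at h2
      rw [h, I.v_local, Finset.filter_singleton, if_neg, h0]
      rintro (h | h)
      · exact h1 (congrArg _ h)
      · exact h2 (congrArg _ h)
  · obtain ⟨e, S, h⟩ := (I.v_normalized ⟨i, hi⟩).1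
    refine ⟨e, e.2, ?_⟩
    have hv := value_toInput I ⟨i, hi⟩ e
    simp only at hv
    rw [hv]
    by_cases heS : e ∈ S
    · rw [Finset.insert_eq_of_mem heS, sub_self] at h
      exact absurd h one_ne_zero
    · rw [hI ⟨i, hi⟩ (insert e S), hI ⟨i, hi⟩ S, Finset.sum_insert heS] at h
      linarith

theorem worth_toInput (hI : I.IsAdditive) (s : RamState) (i b : Fin n) :
    I.v i (s.allocation n m b) = worth I.toInput (s.nat tblOwner 0) i b := by
  rw [hI, RamState.allocation, worth, Finset.sum_filter, Finset.sum_filter]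
  change _ = ∑ e ∈ Finset.range m, _
  rw [Finset.sum_range]
  refine Finset.sum_congr rfl fun e _ => ?_
  rw [value_toInput]

/-- The program solves the problem for every additive instance. -/
theorem runs_orientProg_toInput (hI : I.IsAdditive) :
    Runs I.toInput orientProg .init fun s =>
      I.IsEFOrientationWithin (s.allocation n m) (s.subsidy n) ((n : ℝ) / 2) := by
  have hX := valid_toInput hI
  refine (runs_orientProg hX).imp fun s ⟨⟨T, F, M, best, take, keep, cross, H⟩, hp⟩ => ?_
  obtain ⟨h1, h2, h3⟩ := H.payments hX hp
  have hend : ∀ e : Fin m, s.nat 0 0 e = I.endA e ∨ s.nat 0 0 e = I.endB e := fun e => by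
    have := H.own_eq_end hX (e := e) e.2
    rwa [endA_toInput, endB_toInput] at this
  refine ⟨⟨fun i j hij => ?_, fun e => ?_, fun i e he => ?_⟩, ⟨fun i => h1 i i.2, fun i j => ?_⟩,
    h3⟩
  · rw [Finset.disjoint_left]
    intro e hi hj
    have hi := (Finset.mem_filter.1 hi).2
    have hj := (Finset.mem_filter.1 hj).2
    exact hij (Fin.ext (hi.symm.trans hj))
  · rcases hend e with h | h
    · exact ⟨I.endA e, Finset.mem_filter.2 ⟨Finset.mem_univ _, h⟩⟩
    · exact ⟨I.endB e, Finset.mem_filter.2 ⟨Finset.mem_univ _, h⟩⟩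
  · have he := (Finset.mem_filter.1 he).2
    refine Finset.mem_filter.2 ⟨Finset.mem_univ _, ?_⟩
    have hende := hend e
    rw [he] at hende
    exact hende.imp (fun h => Fin.ext (by omega)) fun h => Fin.ext (by omega)
  · rw [worth_toInput hI, worth_toInput hI]
    exact h2 i i.2 j j.2

end FairOrientation

theorem mainTheorem1 :
    (∀ (n m : ℕ) (I : OrientationInstance n m), I.IsAdditive →
      ∃ (A : Fin n → Finset (Fin m)) (p : Fin n → ℝ),
        I.IsEFOrientationWithin A p ((n : ℝ) / 2)) ∧
    (∃ (c : RamProg) (q : Polynomial ℕ),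
      ∀ (n m : ℕ) (I : OrientationInstance n m), I.IsAdditive →
        ∃ (t : ℕ) (s : RamState),
          RamExec I.toInput c RamState.init t s ∧ t ≤ q.eval (n + m) ∧
          I.IsEFOrientationWithin (s.allocation n m) (s.subsidy n) ((n : ℝ) / 2)) := by
  refine ⟨fun n m I hI => ?_, FairOrientation.orientProg, FairOrientation.cost _, fun n m I hI =>
    FairOrientation.runs_orientProg_toInput hI⟩
  obtain ⟨-, s, -, -, h⟩ := FairOrientation.runs_orientProg_toInput hI
  exact ⟨_, _, h⟩
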